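/- Let $p$ be a prime, $N\in\mathbb Z$, $\alpha>1$, let $dx$ be the Haar measure on $\mathbb Q_p$ with $\int_{\mathbb Z_p}dx=1$, and let $B_N=\{x\in\mathbb Q_p:\ |x|_p\le p^N\}$, a compact additive group, with the restriction of $dx$. Let $\chi(x)=\exp(2\pi i\{x\}_p)$, where $\{x\}_p$ is the $p$-adic fractional part, and put $$\lambda=\frac{p-1}{p^{\alpha+1}-1}\,p^{\alpha(1-N)},\qquad Z(t,x)=\int_{\mathbb Q_p}\chi(\xi x)e^{-t|\xi|_p^\alpha}\,d\xi,$$ $$c(t)=p^{-N}-p^{-N}(1-p^{-1})e^{\lambda t}\sum_{n=0}^\infty\frac{(-1)^n}{n!}t^n\frac{p^{-N\alpha n}}{1-p^{-\alpha n-1}},\qquad Z_N(t,x)=e^{\lambda t}Z(t,x)+c(t).$$ Let $T_N(t)$, $t\ge 0$, be the semigroup on the complex space $L^1(B_N)$ given by $(T_N(t)u)(x)=\int_{B_N}Z_N(t,x-y)u(y)\,dy$ for $t>0$ and $T_N(0)=I$, and let $A_N$ be its generator, in the convention $T_N(t)=e^{-tA_N}$: $A_Nu=\lim_{t\to0+}t^{-1}(u-T_N(t)u)$,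 with domain $\operatorname{Dom}A_N$ the set of all $u\in L^1(B_N)$ for which this limit exists in $L^1(B_N)$. Let $\mathcal D(B_N)$ be the space of locally constant functions $B_N\to\mathbb C$ and $\mathcal D'(B_N)$ the space of distributions, i.e. of linear functionals on $\mathcal D(B_N)$. A function $u\in L^1(B_N)$ is regarded as the distribution $\varphi\mapsto\int_{B_N}u\varphi\,dx$, and the convolution on the additive group $B_N$ of $f,g\in\mathcal D'(B_N)$ is $\langle f*g,\varphi\rangle=\langle f_x,\langle g_y,\varphi(x+y)\rangle\rangle$. For real $\beta\ne1$ let $f_\beta^{(N)}\in\mathcal D'(B_N)$ be $$\langle f_\beta^{(N)},\varphi\rangle=\frac{1-p^{-1}}{1-p^{\beta-1}}p^{\beta N}\varphi(0)+\frac{1-p^{-\beta}}{1-p^{\beta-1}}\int_{B_N}[\varphi(x)-\varphi(0)]\,|x|_p^{\beta-1}\,dx .$$ Theorem. A function $u\in L^1(B_N)$ belongs to $\operatorname{Dom}A_N$ if and only if the distribution $f_{-\alpha}^{(N)}*u$ belongs to $L^1(B_N)$. If $u\in\operatorname{Dom}A_N$, then $A_Nu=f_{-\alpha}^{(N)}*u-\lambda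 u$ in $\mathcal D'(B_N)$. -/

import Mathlib

open MeasureTheory Filter Topology

noncomputable section

namespace VladimirovBall

/-! ### Generators of operator semigroups -/

section Generator

variable {E : Type*} [NormedAddCommGroup E] [NormedSpace ℂ E]

/-- The generator `A` of a semigroup `T t = exp (-t A)` of linear operators on a normed space:
`A u = lim_{t → 0+} (u - T t u) / t`, with domain the set of all `u` for which the limit exists
in norm. -/
def generator (T : ℝ → E →ₗ[ℂ] E) : E →ₗ.[ℂ] E where
  domain :=
    { carrier := {u | ∃ v, Tendsto (fun t : ℝ => (t : ℂ)⁻¹ • (u - T t u)) (𝓝[>] 0) (𝓝 v)}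
      zero_mem' := ⟨0, by simp⟩
      add_mem' := by
        rintro u u' ⟨v, hv⟩ ⟨v', hv'⟩
        refine ⟨v + v', (hv.add hv').congr fun t => ?_⟩
        rw [map_add, ← smul_add]
        congr 1
        abel
      smul_mem' := by
        rintro c u ⟨v, hv⟩
        refine ⟨c • v, (hv.const_smul c).congr fun t => ?_⟩
        rw [map_smul, ← smul_sub, smul_comm] }
  toFun :=
    { toFun := fun u => u.2.choose
      map_add' := fun u u' => by
        refine tendsto_nhds_unique (u + u').2.choose_spec
          ((u.2.choose_spec.add u'.2.choose_spec).congr fun t => ?_)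
        rw [Submodule.coe_add, map_add, ← smul_add]
        congr 1
        abel
      map_smul' := fun c u => by
        refine tendsto_nhds_unique (c • u).2.choose_spec
          ((u.2.choose_spec.const_smul c).congr fun t => ?_)
        rw [Submodule.coe_smul, map_smul, ← smul_sub, smul_comm] }

end Generator

variable (p : ℕ) [Fact p.Prime]

/-! ### Measure and additive character on `ℚ_p` -/

instance instMeasurableSpacePadic : MeasurableSpace ℚ_[p] := borel _

instance instBorelSpacePadic : BorelSpace ℚ_[p] := ⟨rfl⟩

/-- `ℤ_p`, as a compact set with non-empty interior. -/
def unitBall : TopologicalSpace.PositiveCompacts ℚ_[p] where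
  carrier := Metric.closedBall 0 1
  isCompact' := isCompact_closedBall 0 1
  interior_nonempty' :=
    ⟨0, Metric.ball_subset_interior_closedBall (Metric.mem_ball_self one_pos)⟩

/-- The Haar measure `dx` on `ℚ_p` with `ℤ_p` of measure one. -/
def haar : Measure ℚ_[p] := Measure.addHaarMeasure (unitBall p)

variable {p}

theorem norm_mul_pow_le (x : ℚ_[p]) : ‖x * (p : ℚ_[p]) ^ (-x.valuation).toNat‖ ≤ 1 := by
  rcases eq_or_ne x 0 with rfl | hx
  · simp
  have hp : (1 : ℝ) < p := by exact_mod_cast (Fact.out : p.Prime).one_lt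
  rw [norm_mul, Padic.norm_eq_zpow_neg_valuation hx, norm_pow, Padic.norm_p, inv_pow,
    ← zpow_natCast, ← zpow_neg, ← zpow_add₀ (by positivity)]
  refine zpow_le_one_of_nonpos₀ hp.le ?_
  omega

/-- `p ^ m x ∈ ℤ_p`, where `m = max (0, log_p |x|_p)`. -/
def scaled (x : ℚ_[p]) : ℤ_[p] :=
  (⟨x * (p : ℚ_[p]) ^ (-x.valuation).toNat, norm_mul_pow_le x⟩ : {z : ℚ_[p] // ‖z‖ ≤ 1})

theorem coe_scaled (x : ℚ_[p]) :
    ((scaled x : ℤ_[p]) : ℚ_[p]) = x * (p : ℚ_[p]) ^ (-x.valuation).toNat := rfl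

/-- The fractional part `{x}_p`: if `|x|_p = p ^ m` with `m > 0` and
`x = p ^ (-m) (x_0 + x_1 p + ⋯)`, it is `p ^ (-m) (x_0 + ⋯ + x_{m-1} p ^ (m-1))`,
the numerator being the representative in `[0, p ^ m)` of `p ^ m x` modulo `p ^ m`;
it is `0` if `x ∈ ℤ_p`. -/
def fractPart (x : ℚ_[p]) : ℚ :=
  ((PadicInt.toZModPow (-x.valuation).toNat (scaled x)).val : ℚ) /
    (p : ℚ) ^ (-x.valuation).toNat

/-- The additive character `χ(x) = exp (2 π i {x}_p)` of `ℚ_p`. -/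
def chi (x : ℚ_[p]) : ℂ := Complex.exp (2 * Real.pi * Complex.I * (fractPart x : ℂ))

theorem fractPart_eq_zero_of_norm_le_one {x : ℚ_[p]} (hx : ‖x‖ ≤ 1) : fractPart x = 0 := by
  have h0 : (-x.valuation).toNat = 0 := by
    have := (Padic.norm_le_one_iff_val_nonneg x).1 hx
    omega
  unfold fractPart
  rw [h0]
  have hs : Subsingleton (ZMod (p ^ 0)) := by rw [pow_zero]; infer_instance
  have h1 : PadicInt.toZModPow 0 (scaled x) = 0 := Subsingleton.elim _ _
  rw [h1]
  have h2 : (0 : ZMod (p ^ 0)).val = 0 := ZMod.val_zero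
  rw [h2]
  simp

theorem fractPart_add {x h : ℚ_[p]} (hh : ‖h‖ ≤ 1) : fractPart (x + h) = fractPart x := by
  by_cases hx : ‖x‖ ≤ 1
  · rw [fractPart_eq_zero_of_norm_le_one hx, fractPart_eq_zero_of_norm_le_one
      ((Padic.nonarchimedean x h).trans (max_le hx hh))]
  push Not at hx
  have hne : ‖x‖ ≠ ‖h‖ := (lt_of_le_of_lt hh hx).ne'
  have hnorm : ‖x + h‖ = ‖x‖ := by
    rw [IsUltrametricDist.norm_add_eq_max_of_norm_ne_norm hne]
    exact max_eq_left (hh.trans hx.le)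
  have hx0 : x ≠ 0 := by
    rintro rfl
    rw [norm_zero] at hx
    linarith
  have hxh0 : x + h ≠ 0 := by
    rw [← norm_ne_zero_iff, hnorm]
    exact norm_ne_zero_iff.2 hx0
  have hp : (1 : ℝ) < p := by exact_mod_cast (Fact.out : p.Prime).one_lt
  have hval : (x + h).valuation = x.valuation := by
    rw [Padic.norm_eq_zpow_neg_valuation hx0, Padic.norm_eq_zpow_neg_valuation hxh0] at hnorm
    have := zpow_right_injective₀ (by linarith) hp.ne' hnorm
    simpa using this
  obtain ⟨h', hh'⟩ : ∃ h' : ℤ_[p], (h' : ℚ_[p]) = h := ⟨⟨h, hh⟩, rfl⟩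
  have hs : scaled (x + h) - scaled x =
      (p : ℤ_[p]) ^ (-x.valuation).toNat * h' := by
    apply Subtype.ext
    rw [PadicInt.coe_sub, coe_scaled, coe_scaled, hval, PadicInt.coe_mul, PadicInt.coe_pow,
      PadicInt.coe_natCast, hh']
    ring
  have hz : PadicInt.toZModPow (-x.valuation).toNat (scaled (x + h)) =
      PadicInt.toZModPow (-x.valuation).toNat (scaled x) := by
    rw [← sub_eq_zero, ← map_sub, ← RingHom.mem_ker, PadicInt.ker_toZModPow,
      Ideal.mem_span_singleton]
    exact ⟨_, hs⟩
  unfold fractPart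
  rw [hval, hz]

theorem measurable_chi : Measurable (chi : ℚ_[p] → ℂ) := by
  have : IsLocallyConstant (chi : ℚ_[p] → ℂ) := by
    rw [IsLocallyConstant.iff_exists_open]
    intro x
    refine ⟨Metric.ball x 1, Metric.isOpen_ball, Metric.mem_ball_self one_pos, fun y hy => ?_⟩
    have hy' : ‖y - x‖ ≤ 1 := by rw [← dist_eq_norm]; exact (Metric.mem_ball.1 hy).le
    have := fractPart_add (x := x) hy'
    rw [add_sub_cancel] at this
    simp only [chi, this]
  exact this.continuous.measurable

theorem norm_chi (x : ℚ_[p]) : ‖chi x‖ = 1 := by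
  have : chi x = Complex.exp (((2 * Real.pi * (fractPart x : ℝ) : ℝ) : ℂ) * Complex.I) := by
    unfold chi
    congr 1
    push_cast
    ring
  rw [this, Complex.norm_exp_ofReal_mul_I]

/-- The heat kernel on `ℚ_p`:
`Z(t,x) = ∫_{ℚ_p} χ(ξ x) exp (-t |ξ|_p ^ α) dξ`. -/
def heatKernel (α t : ℝ) (x : ℚ_[p]) : ℂ :=
  ∫ ξ, chi (ξ * x) * (Real.exp (-t * ‖ξ‖ ^ α) : ℂ) ∂(haar p)

variable (p)

/-! ### The ball `B_N` -/

/-- The ball `B_N = {x ∈ ℚ_p : |x|_p ≤ p ^ N}`, as a subgroup of the additive group of `ℚ_p`. -/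
def Ball (N : ℤ) : AddSubgroup ℚ_[p] where
  carrier := {x | ‖x‖ ≤ (p : ℝ) ^ N}
  zero_mem' := by
    change ‖(0 : ℚ_[p])‖ ≤ (p : ℝ) ^ N
    rw [norm_zero]
    positivity
  add_mem' := fun {x y} hx hy => (Padic.nonarchimedean x y).trans (max_le hx hy)
  neg_mem' := fun {x} hx => by simpa using hx

theorem coe_ball (N : ℤ) :
    (Ball p N : Set ℚ_[p]) = Metric.closedBall 0 ((p : ℝ) ^ N) := by
  ext x
  simp [Ball]

instance instCompactSpaceBall (N : ℤ) : CompactSpace (Ball p N) :=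
  isCompact_iff_compactSpace.1 (by rw [coe_ball]; exact isCompact_closedBall _ _)

/-- The measure `dx` on `B_N`: the restriction of the Haar measure of `ℚ_p`. -/
def ballMeasure (N : ℤ) : Measure (Ball p N) := (haar p).comap Subtype.val

theorem measurableSet_ball (N : ℤ) : MeasurableSet (Ball p N : Set ℚ_[p]) := by
  rw [coe_ball]
  exact Metric.isClosed_closedBall.measurableSet

instance instIsFiniteMeasureBallMeasure (N : ℤ) : IsFiniteMeasure (ballMeasure p N) := by
  constructor
  have h := comap_subtype_coe_apply (measurableSet_ball p N) (haar p) Set.univ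
  rw [Set.image_univ, Subtype.range_coe_subtype] at h
  refine h.trans_lt ?_
  have h2 : {x | x ∈ (Ball p N : Set ℚ_[p])} = Metric.closedBall 0 ((p : ℝ) ^ N) := coe_ball p N
  rw [h2]
  unfold haar
  exact (isCompact_closedBall _ _).measure_lt_top

/-- The complex space `L¹(B_N)`. -/
abbrev L1 (N : ℤ) : Type := Lp ℂ 1 (ballMeasure p N)

/-! ### The semigroup `T_N` on `L¹(B_N)` and its generator -/

/-- `λ = (p - 1) / (p ^ (α + 1) - 1) * p ^ (α (1 - N))`. -/
def lam (N : ℤ) (α : ℝ) : ℝ :=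
  ((p : ℝ) - 1) / ((p : ℝ) ^ (α + 1) - 1) * (p : ℝ) ^ (α * (1 - N))

/-- `c(t) = p^{-N} - p^{-N} (1 - p^{-1}) e^{λ t}
  ∑_n (-1)^n / n! * t^n * p^{-N α n} / (1 - p^{-α n - 1})`. -/
def cFun (N : ℤ) (α t : ℝ) : ℝ :=
  (p : ℝ) ^ (-N) - (p : ℝ) ^ (-N) * (1 - (p : ℝ)⁻¹) * Real.exp (lam p N α * t) *
    ∑' n : ℕ, (-1 : ℝ) ^ n / n.factorial * t ^ n *
      ((p : ℝ) ^ (-(N : ℝ) * α * n) / (1 - (p : ℝ) ^ (-α * n - 1)))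

/-- The heat kernel on the ball: `Z_N(t,x) = e^{λ t} Z(t,x) + c(t)`, `x ∈ B_N`. -/
def ballHeatKernel (N : ℤ) (α t : ℝ) (x : Ball p N) : ℂ :=
  (Real.exp (lam p N α * t) : ℂ) * heatKernel α t (x : ℚ_[p]) + (cFun p N α t : ℂ)

theorem stronglyMeasurable_ballHeatKernel (N : ℤ) (α t : ℝ) :
    StronglyMeasurable (ballHeatKernel p N α t) := by
  have hZ : StronglyMeasurable (heatKernel α t : ℚ_[p] → ℂ) := by
    unfold heatKernel haar
    refine StronglyMeasurable.integral_prod_right (f := fun x ξ =>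
      chi (ξ * x) * (Real.exp (-t * ‖ξ‖ ^ α) : ℂ)) ?_
    apply Measurable.stronglyMeasurable
    have h1 : Measurable fun z : ℚ_[p] × ℚ_[p] => chi (z.2 * z.1) :=
      measurable_chi.comp (measurable_snd.mul measurable_fst)
    have h2 : Measurable fun z : ℚ_[p] × ℚ_[p] => (Real.exp (-t * ‖z.2‖ ^ α) : ℂ) := by
      fun_prop
    exact h1.mul h2
  exact ((hZ.comp_measurable measurable_subtype_coe).const_mul _).add_const _

theorem exists_norm_ballHeatKernel_le (N : ℤ) (α t : ℝ) :
    ∃ C, ∀ x, ‖ballHeatKernel p N α t x‖ ≤ C := by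
  refine ⟨Real.exp (lam p N α * t) * (∫ ξ, Real.exp (-t * ‖ξ‖ ^ α) ∂(haar p)) +
    ‖(cFun p N α t : ℂ)‖, fun x => ?_⟩
  refine (norm_add_le _ _).trans (add_le_add ?_ le_rfl)
  rw [norm_mul, Complex.norm_real, Real.norm_of_nonneg (Real.exp_pos _).le]
  refine mul_le_mul_of_nonneg_left ?_ (Real.exp_pos _).le
  refine (norm_integral_le_integral_norm _).trans_eq ?_
  congr 1
  ext ξ
  rw [norm_mul, norm_chi, one_mul, Complex.norm_real, Real.norm_of_nonneg (Real.exp_pos _).le]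

variable {p}

theorem memLp_kernel {N : ℤ} {k : Ball p N → ℂ} (hk : StronglyMeasurable k)
    (hb : ∃ C, ∀ x, ‖k x‖ ≤ C) (u : L1 p N) :
    MemLp (fun x => ∫ y, k (x - y) * u y ∂(ballMeasure p N)) 1 (ballMeasure p N) := by
  obtain ⟨C, hC⟩ := hb
  have hu : Integrable u (ballMeasure p N) := L1.integrable_coeFn u
  refine MemLp.of_bound (C := ∫ y, C * ‖u y‖ ∂(ballMeasure p N)) ?_ ?_
  · refine (StronglyMeasurable.integral_prod_right (f := fun x y => k (x - y) * u y)
      ?_).aestronglyMeasurable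
    exact (hk.comp_measurable (measurable_fst.sub measurable_snd)).mul
      ((Lp.stronglyMeasurable u).comp_measurable measurable_snd)
  · refine Eventually.of_forall fun x => ?_
    refine norm_integral_le_of_norm_le (hu.norm.const_mul C) (Eventually.of_forall fun y => ?_)
    rw [norm_mul]
    exact mul_le_mul_of_nonneg_right (hC _) (norm_nonneg _)

theorem integrable_kernel {N : ℤ} {k : Ball p N → ℂ} (hk : StronglyMeasurable k)
    (hb : ∃ C, ∀ x, ‖k x‖ ≤ C) (u : L1 p N) (x : Ball p N) :
    Integrable (fun y => k (x - y) * u y) (ballMeasure p N) := by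
  obtain ⟨C, hC⟩ := hb
  refine (L1.integrable_coeFn u).bdd_mul (c := C) ?_ (Eventually.of_forall fun y => hC _)
  exact (hk.comp_measurable (measurable_const.sub measurable_id)).aestronglyMeasurable

/-- The operator `u ↦ ∫_{B_N} k(x - y) u(y) dy` on `L¹(B_N)`, for a bounded measurable `k`. -/
def kernelOp {N : ℤ} (k : Ball p N → ℂ) (hk : StronglyMeasurable k)
    (hb : ∃ C, ∀ x, ‖k x‖ ≤ C) : L1 p N →ₗ[ℂ] L1 p N where
  toFun u := (memLp_kernel hk hb u).toLp
  map_add' u v := by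
    rw [← MemLp.toLp_add, MemLp.toLp_eq_toLp_iff]
    refine Eventually.of_forall fun x => ?_
    rw [Pi.add_apply, ← integral_add (integrable_kernel hk hb u x) (integrable_kernel hk hb v x)]
    refine integral_congr_ae ?_
    filter_upwards [Lp.coeFn_add u v] with y hy
    rw [hy, Pi.add_apply, mul_add]
  map_smul' c u := by
    rw [RingHom.id_apply, ← MemLp.toLp_const_smul, MemLp.toLp_eq_toLp_iff]
    refine Eventually.of_forall fun x => ?_
    rw [Pi.smul_apply, ← integral_smul]
    refine integral_congr_ae ?_
    filter_upwards [Lp.coeFn_smul c u] with y hy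
    rw [hy, Pi.smul_apply, smul_eq_mul, smul_eq_mul, mul_left_comm]

variable (p)

/-- The semigroup `(T_N(t) u)(x) = ∫_{B_N} Z_N(t, x - y) u(y) dy`, `t > 0`, on `L¹(B_N)`;
it is the identity at `t = 0`. -/
def semigroupT (N : ℤ) (α t : ℝ) : L1 p N →ₗ[ℂ] L1 p N :=
  open Classical in
  if 0 < t then
    kernelOp (ballHeatKernel p N α t) (stronglyMeasurable_ballHeatKernel p N α t)
      (exists_norm_ballHeatKernel_le p N α t)
  else LinearMap.id

/-- The generator `A_N` of the semigroup `T_N` on `L¹(B_N)`. -/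
def generatorA (N : ℤ) (α : ℝ) : L1 p N →ₗ.[ℂ] L1 p N := generator (semigroupT p N α)

/-! ### Distributions on `B_N` -/

/-- The space `𝒟(B_N)` of test functions: all locally constant complex functions on `B_N`. -/
abbrev TestFunction (N : ℤ) : Type := LocallyConstant (Ball p N) ℂ

/-- The space `𝒟'(B_N)` of distributions: all linear functionals on `𝒟(B_N)` (the topology of
`𝒟(B_N)`, an inductive limit of finite-dimensional spaces, makes each of them continuous). -/
abbrev Distribution (N : ℤ) : Type := TestFunction p N →ₗ[ℂ] ℂ

variable {p} {N : ℤ}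

theorem exists_forall_dist_lt (φ : TestFunction p N) :
    ∃ δ > 0, ∀ x y : Ball p N, dist x y < δ → φ x = φ y := by
  let _ : UniformSpace ℂ := ⊥
  have hc : Continuous[_, ⊥] φ := by
    have := φ.isLocallyConstant
    exact ⟨fun s _ => this s⟩
  have hu : UniformContinuous φ := CompactSpace.uniformContinuous_of_continuous hc
  have := hu (show {q : ℂ × ℂ | q.1 = q.2} ∈ @uniformity ℂ ⊥ from by
    change _ ∈ 𝓟 _
    rw [mem_principal]
    rintro ⟨a, b⟩ hab
    exact hab)
  obtain ⟨δ, hδ, h⟩ := Metric.mem_uniformity_dist.1 (mem_map.1 this)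
  exact ⟨δ, hδ, fun x y hxy => h hxy⟩

/-- The translate `y ↦ φ(x + y)` of a test function. -/
def translate (x : Ball p N) (φ : TestFunction p N) : TestFunction p N :=
  φ.comap ⟨fun y => x + y, by fun_prop⟩

theorem isLocallyConstant_translate (φ : TestFunction p N) :
    IsLocallyConstant fun x => translate x φ := by
  obtain ⟨δ, hδ, h⟩ := exists_forall_dist_lt φ
  rw [IsLocallyConstant.iff_exists_open]
  intro x
  refine ⟨Metric.ball x δ, Metric.isOpen_ball, Metric.mem_ball_self hδ, fun x' hx' => ?_⟩
  ext y
  refine h _ _ ?_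
  simpa using hx'

/-- The convolution of distributions on the additive group of `B_N`:
`⟨f * g, φ⟩ = ⟨f_x, ⟨g_y, φ(x + y)⟩⟩`. -/
def conv (f g : Distribution p N) : Distribution p N where
  toFun φ := f ⟨fun x => g (translate x φ), (isLocallyConstant_translate φ).comp g⟩
  map_add' φ ψ := by
    rw [← map_add]
    congr 1
    ext x
    exact map_add g (translate x φ) (translate x ψ)
  map_smul' c φ := by
    rw [RingHom.id_apply, ← map_smul]
    congr 1
    ext x
    exact map_smul g c (translate x φ)

/-- A function `u ∈ L¹(B_N)` as a distribution: `⟨u, φ⟩ = ∫_{B_N} u(x) φ(x) dx`. -/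
def ofL1 (u : L1 p N) : Distribution p N where
  toFun φ := ∫ x, u x * φ x ∂(ballMeasure p N)
  map_add' φ ψ := by
    have hint : ∀ φ : TestFunction p N, Integrable (fun x => u x * φ x) (ballMeasure p N) := by
      intro φ
      obtain ⟨C, hC⟩ := (isCompact_range φ.continuous).isBounded.exists_norm_le
      exact (L1.integrable_coeFn u).mul_bdd (c := C) φ.continuous.aestronglyMeasurable
        (Eventually.of_forall fun x => hC _ ⟨x, rfl⟩)
    rw [← integral_add (hint φ) (hint ψ)]
    simp [mul_add]
  map_smul' c φ := by
    rw [RingHom.id_apply, smul_eq_mul, ← integral_const_mul]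
    simp [mul_left_comm]

theorem integrable_regularized (s : ℝ) (φ : TestFunction p N) :
    Integrable (fun x : Ball p N => (φ x - φ 0) * ((‖(x : ℚ_[p])‖ ^ s : ℝ) : ℂ))
      (ballMeasure p N) := by
  have hcont : Continuous
      fun x : Ball p N => (φ x - φ 0) * ((‖(x : ℚ_[p])‖ ^ s : ℝ) : ℂ) := by
    rw [continuous_iff_continuousAt]
    intro x
    by_cases hx : x = 0
    · subst hx
      have : (fun x : Ball p N => (φ x - φ 0) * ((‖(x : ℚ_[p])‖ ^ s : ℝ) : ℂ))
          =ᶠ[𝓝 0] fun _ => 0 := by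
        filter_upwards [φ.isLocallyConstant.eventually_eq 0] with y hy
        have hy' : φ y = φ 0 := hy
        rw [hy', sub_self, zero_mul]
      exact continuousAt_const.congr this.symm
    · have hx' : ‖(x : ℚ_[p])‖ ≠ 0 := by simpa using hx
      refine ((φ.continuous.sub continuous_const).continuousAt).mul ?_
      refine Complex.continuous_ofReal.continuousAt.comp ?_
      exact ContinuousAt.rpow_const (by fun_prop) (Or.inl hx')
  obtain ⟨C, hC⟩ := (isCompact_range hcont).isBounded.exists_norm_le
  exact Integrable.of_bound hcont.aestronglyMeasurable C
    (Eventually.of_forall fun x => hC _ ⟨x, rfl⟩)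

variable (p N)

/-- The Riesz distribution `f_β^{(N)}` on `B_N`, for real `β ≠ 1`:
`⟨f_β, φ⟩ = (1 - p^{-1}) / (1 - p^{β-1}) p^{β N} φ(0)
  + (1 - p^{-β}) / (1 - p^{β-1}) ∫_{B_N} (φ(x) - φ(0)) |x|_p^{β-1} dx`. -/
def riesz (β : ℝ) : Distribution p N where
  toFun φ :=
    (((1 - (p : ℝ)⁻¹) / (1 - (p : ℝ) ^ (β - 1)) * (p : ℝ) ^ (β * N) : ℝ) : ℂ) * φ 0 +
    (((1 - (p : ℝ) ^ (-β)) / (1 - (p : ℝ) ^ (β - 1)) : ℝ) : ℂ) *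
      ∫ x : Ball p N, (φ x - φ 0) * ((‖(x : ℚ_[p])‖ ^ (β - 1) : ℝ) : ℂ) ∂(ballMeasure p N)
  map_add' φ ψ := by
    have h : ∫ x : Ball p N, ((φ + ψ) x - (φ + ψ) 0) * ((‖(x : ℚ_[p])‖ ^ (β - 1) : ℝ) : ℂ)
          ∂(ballMeasure p N) =
        (∫ x : Ball p N, (φ x - φ 0) * ((‖(x : ℚ_[p])‖ ^ (β - 1) : ℝ) : ℂ) ∂(ballMeasure p N)) +
        ∫ x : Ball p N, (ψ x - ψ 0) * ((‖(x : ℚ_[p])‖ ^ (β - 1) : ℝ) : ℂ)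
          ∂(ballMeasure p N) := by
      rw [← integral_add (integrable_regularized _ φ) (integrable_regularized _ ψ)]
      congr 1
      ext x
      simp only [LocallyConstant.coe_add, Pi.add_apply]
      ring
    rw [h, LocallyConstant.coe_add, Pi.add_apply]
    ring
  map_smul' c φ := by
    have h : ∫ x : Ball p N, ((c • φ) x - (c • φ) 0) * ((‖(x : ℚ_[p])‖ ^ (β - 1) : ℝ) : ℂ)
          ∂(ballMeasure p N) =
        c * ∫ x : Ball p N, (φ x - φ 0) * ((‖(x : ℚ_[p])‖ ^ (β - 1) : ℝ) : ℂ)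
          ∂(ballMeasure p N) := by
      rw [← integral_const_mul]
      congr 1
      ext x
      simp only [LocallyConstant.coe_smul, Pi.smul_apply, smul_eq_mul]
      ring
    rw [h, LocallyConstant.coe_smul, Pi.smul_apply, RingHom.id_apply, smul_eq_mul, smul_eq_mul]
    ring

end VladimirovBall

end

/-!
The proof replaces Fourier series on `B_N` by averages over balls. Let `E_k`, `k ≤ N`, be the
convolution with the normalised indicator `p ^ (-k) 1_{B_k}` (`ballKernel`, `averageOp`). The
operators `E_k` are contractions of `L¹(B_N)`, `E_l E_k = E_l` for `k ≤ l`, and `E_k u → u` as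
`k → -∞` (`tendsto_averageOp`). Both the semigroup and the convolution with the Riesz distribution
are multipliers for the decomposition `u = E_N u + ∑_{k < N} (E_k - E_{k+1}) u`.

* `T_N(t)` acts on the range of `E_k - E_{k+1}` as `exp (-t μ_k)` with `μ_k = p ^ (-k α) - λ > 0`,
  because averaging `Z(t, ·)` over `B_k` cuts its Fourier transform `exp (-t |ξ| ^ α)` off outside
  the dual ball and the transform is constant on spheres (`average_heatKernel`,
  `convFun_ballKernel_sub_ballHeatKernel`). It acts as the identity on the constants, because the
  series in `c(t)` is, up to the factor `p ^ (-N) (1 - p⁻¹)`, the integral of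
  `exp (-t |ξ| ^ α)` over the ball `|ξ| ≤ p ^ (-N)`
  (`exp_mul_setIntegral_add_cFun`).
* Convolution with `f_{-α}` acts on the range of `E_k - E_{k+1}` as `p ^ (-k α)`, and on the
  constants as `λ`: the regularised integral is cut into spheres and summed by parts
  (`riesz_apply_eq_sum`, `conv_riesz_averageTest`). Since the functions
  `y ↦ p ^ (-k) 1_{B_k}(x - y)` span the test functions (`distribution_ext`), the identity
  `f_{-α} * u = v + λ u` in `𝒟'(B_N)` says exactly that `E_N v = 0` and
  `(E_k - E_{k+1}) v = μ_k (E_k - E_{k+1}) u` for `k < N` (`conv_riesz_eq_ofL1_iff`).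

If the difference quotients `(u - T_N(t) u) / t` converge to `v`, so do their averages, which gives
this identity. Conversely, under this identity the difference quotient is obtained from `v` by the
multipliers `m_k(t) = (1 - exp (-t μ_k)) / (t μ_k)`. They lie in `[0, 1]` and decrease as
`k → -∞`, so summation by parts turns the multiplier into a positive combination of the
contractions `E_k` with total weight one. For each fixed `k`, `m_k(t) → 1` as `t → 0`, so the
weight moves to the averages over small balls, which are close to `v`
(`norm_sub_le_of_antitone_multiplier`). Hence the difference quotients converge to `v`.
-/

noncomputable section

namespace VladimirovBall

variable {p : ℕ} [hp : Fact p.Prime]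

/-! ### The measure of balls in `ℚ_p` -/

instance : (haar p).IsAddHaarMeasure := by unfold haar; infer_instance

theorem one_lt_cast : (1 : ℝ) < p := by exact_mod_cast hp.out.one_lt

theorem cast_pos : (0 : ℝ) < p := by exact_mod_cast hp.out.pos

theorem norm_prime_zpow (k : ℤ) : ‖(p : ℚ_[p]) ^ k‖ = (p : ℝ) ^ (-k) := by
  rw [norm_zpow, Padic.norm_p, inv_zpow, zpow_neg]

/-- A ball of radius `p ^ (k + 1)` consists of `p` cosets of the ball of radius `p ^ k`. -/
theorem closedBall_zpow_succ (k : ℤ) :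
    Metric.closedBall (0 : ℚ_[p]) ((p : ℝ) ^ (k + 1)) =
      ⋃ i ∈ Finset.range p, Metric.closedBall ((i : ℚ_[p]) * (p : ℚ_[p]) ^ (-(k + 1)))
        ((p : ℝ) ^ k) := by
  have hp0 : (p : ℚ_[p]) ≠ 0 := by exact_mod_cast hp.out.ne_zero
  have hpp := cast_pos (p := p)
  ext x
  simp only [mem_closedBall_iff_norm, sub_zero, Set.mem_iUnion, Finset.mem_range, exists_prop]
  constructor
  · intro hx
    have hy : ‖x * (p : ℚ_[p]) ^ (k + 1)‖ ≤ 1 := by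
      rw [norm_mul, norm_prime_zpow, zpow_neg]
      exact mul_inv_le_one_of_le₀ hx (by positivity)
    obtain ⟨y, hyx⟩ : ∃ y : ℤ_[p], (y : ℚ_[p]) = x * (p : ℚ_[p]) ^ (k + 1) := ⟨⟨_, hy⟩, rfl⟩
    obtain ⟨n, hn, hmem⟩ := PadicInt.exists_mem_range y
    refine ⟨n, hn, ?_⟩
    rw [PadicInt.maximalIdeal_eq_span_p, ← pow_one (p : ℤ_[p]),
      ← PadicInt.norm_le_pow_iff_mem_span_pow, PadicInt.norm_def,
      PadicInt.coe_sub, PadicInt.coe_natCast, Nat.cast_one, hyx] at hmem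
    have : x - n * (p : ℚ_[p]) ^ (-(k + 1)) =
        (x * (p : ℚ_[p]) ^ (k + 1) - n) * (p : ℚ_[p]) ^ (-(k + 1)) := by
      rw [sub_mul, mul_assoc, ← zpow_add₀ hp0]
      simp
    rw [this, norm_mul, norm_prime_zpow]
    calc _ ≤ (p : ℝ) ^ (-1 : ℤ) * (p : ℝ) ^ (-(-(k + 1))) :=
        mul_le_mul_of_nonneg_right hmem (by positivity)
      _ = (p : ℝ) ^ k := by rw [← zpow_add₀ hpp.ne']; congr 1; ring
  · rintro ⟨i, -, hi⟩
    have h1 : ‖(i : ℚ_[p]) * (p : ℚ_[p]) ^ (-(k + 1))‖ ≤ (p : ℝ) ^ (k + 1) := by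
      rw [norm_mul, norm_prime_zpow, neg_neg]
      exact mul_le_of_le_one_left (by positivity) (by exact_mod_cast Padic.norm_int_le_one (p := p) i)
    have h2 := Padic.nonarchimedean (x - (i : ℚ_[p]) * (p : ℚ_[p]) ^ (-(k + 1)))
      ((i : ℚ_[p]) * (p : ℚ_[p]) ^ (-(k + 1)))
    rw [sub_add_cancel] at h2
    refine h2.trans (max_le (hi.trans ?_) h1)
    exact zpow_le_zpow_right₀ one_lt_cast.le (by omega)

theorem haar_closedBall_succ (k : ℤ) :
    haar p (Metric.closedBall 0 ((p : ℝ) ^ (k + 1))) =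
      p * haar p (Metric.closedBall 0 ((p : ℝ) ^ k)) := by
  have hpp := cast_pos (p := p)
  rw [closedBall_zpow_succ, measure_biUnion_finset]
  · simp_rw [Measure.addHaar_closedBall_center (haar p) _ ((p : ℝ) ^ k)]
    simp
  · intro i hi j hj hij
    rw [Function.onFun, Set.disjoint_left]
    intro x hx hx'
    rw [mem_closedBall_iff_norm] at hx hx'
    have h1 := Padic.nonarchimedean ((i : ℚ_[p]) * (p : ℚ_[p]) ^ (-(k + 1)) - x)
      (x - (j : ℚ_[p]) * (p : ℚ_[p]) ^ (-(k + 1)))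
    rw [norm_sub_rev] at hx
    rw [sub_add_sub_cancel, ← sub_mul, norm_mul, norm_prime_zpow, neg_neg] at h1
    have h2 := h1.trans (max_le hx hx')
    have h3 : ‖(((i : ℤ) - (j : ℤ) : ℤ) : ℚ_[p])‖ ≤ (p : ℝ) ^ (-((1 : ℕ) : ℤ)) := by
      push_cast
      refine le_of_mul_le_mul_right ?_ (zpow_pos hpp (k + 1))
      refine h2.trans_eq ?_
      rw [← zpow_add₀ hpp.ne']
      congr 1
      simp
    rw [Padic.norm_int_le_pow_iff_dvd, pow_one] at h3
    have hi' := Finset.mem_range.1 (Finset.mem_coe.1 hi)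
    have hj' := Finset.mem_range.1 (Finset.mem_coe.1 hj)
    have := Int.eq_zero_of_abs_lt_dvd h3 (by rw [abs_lt]; omega)
    omega
  · exact fun i _ => Metric.isClosed_closedBall.measurableSet

theorem haar_closedBall (k : ℤ) :
    haar p (Metric.closedBall 0 ((p : ℝ) ^ k)) = (p : ENNReal) ^ k := by
  have hp0 : (p : ENNReal) ≠ 0 := by exact_mod_cast hp.out.ne_zero
  have hpt : (p : ENNReal) ≠ ⊤ := ENNReal.natCast_ne_top p
  induction k using Int.induction_on with
  | zero =>
    rw [zpow_zero, zpow_zero]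
    exact Measure.addHaarMeasure_self
  | succ k ih => rw [haar_closedBall_succ, ih, ENNReal.zpow_add hp0 hpt, zpow_one, mul_comm]
  | pred k ih =>
    have h := haar_closedBall_succ (p := p) (-(k : ℤ) - 1)
    rw [sub_add_cancel, ih] at h
    rw [ENNReal.zpow_sub hp0 hpt, h, zpow_one, mul_comm, ← mul_assoc,
      ENNReal.inv_mul_cancel hp0 hpt, one_mul]

theorem haar_real_closedBall (k : ℤ) :
    (haar p).real (Metric.closedBall 0 ((p : ℝ) ^ k)) = (p : ℝ) ^ k := by
  rw [Measure.real, haar_closedBall]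
  cases k <;> simp

/-! ### The additive character of `ℚ_p` -/

theorem norm_sub_fractPart_le (x : ℚ_[p]) : ‖x - (fractPart x : ℚ_[p])‖ ≤ 1 := by
  have hp0 : (p : ℚ_[p]) ≠ 0 := by exact_mod_cast hp.out.ne_zero
  have hpp := cast_pos (p := p)
  set m := (-x.valuation).toNat with hm
  have h1 : scaled x - ((PadicInt.toZModPow m (scaled x)).val : ℤ_[p]) ∈
      Ideal.span {(p : ℤ_[p]) ^ m} := by
    have : NeZero (p ^ m) := ⟨pow_ne_zero _ hp.out.ne_zero⟩
    rw [← PadicInt.ker_toZModPow, RingHom.mem_ker, map_sub, map_natCast, ZMod.natCast_val,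
      ZMod.cast_id', id, sub_self]
  rw [← PadicInt.norm_le_pow_iff_mem_span_pow, PadicInt.norm_def] at h1
  push_cast at h1
  rw [coe_scaled] at h1
  have h2 : x - (fractPart x : ℚ_[p]) = (x * (p : ℚ_[p]) ^ m -
      ((PadicInt.toZModPow m (scaled x)).val : ℚ_[p])) * ((p : ℚ_[p]) ^ m)⁻¹ := by
    unfold fractPart
    rw [sub_mul, mul_assoc, mul_inv_cancel₀ (pow_ne_zero _ hp0)]
    push_cast
    ring
  rw [h2, norm_mul, norm_inv, norm_pow, Padic.norm_p]
  calc _ ≤ (p : ℝ) ^ (-(m : ℤ)) * (((p : ℝ)⁻¹) ^ m)⁻¹ := by gcongr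
    _ = 1 := by
      rw [zpow_neg, zpow_natCast, inv_pow, inv_inv]
      exact inv_mul_cancel₀ (by positivity)

/-- A rational number whose denominator is a power of `p` and which is a `p`-adic integer
is an integer. -/
theorem exists_int_eq_of_norm_le_one {q : ℚ} {z : ℤ} {m : ℕ} (hq : q * p ^ m = z)
    (h : ‖(q : ℚ_[p])‖ ≤ 1) : ∃ n : ℤ, q = n := by
  have hp0 : (p : ℚ) ≠ 0 := by exact_mod_cast hp.out.ne_zero
  have hdvd : (p : ℤ) ^ m ∣ z := by
    rw [← Padic.norm_int_le_pow_iff_dvd]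
    have : (z : ℚ_[p]) = (q : ℚ_[p]) * (p : ℚ_[p]) ^ m := by exact_mod_cast hq.symm
    rw [this, norm_mul, norm_pow, Padic.norm_p, zpow_neg, zpow_natCast, inv_pow]
    exact mul_le_of_le_one_left (by positivity) h
  obtain ⟨n, rfl⟩ := hdvd
  refine ⟨n, mul_right_cancel₀ (pow_ne_zero m hp0) ?_⟩
  rw [hq]
  push_cast
  ring

theorem fractPart_mul_pow (x : ℚ_[p]) :
    fractPart x * p ^ (-x.valuation).toNat =
      (((PadicInt.toZModPow (-x.valuation).toNat (scaled x)).val : ℤ) : ℚ) := by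
  have hp0 : (p : ℚ) ≠ 0 := by exact_mod_cast hp.out.ne_zero
  unfold fractPart
  rw [div_mul_cancel₀ _ (pow_ne_zero _ hp0)]
  push_cast
  rfl

/-- The fractional part is additive modulo `ℤ`: the defect is a `p`-adic integer with denominator
a power of `p`. -/
theorem exists_fractPart_add_eq (x y : ℚ_[p]) :
    ∃ n : ℤ, fractPart (x + y) = fractPart x + fractPart y + n := by
  have hx := fractPart_mul_pow x
  have hy := fractPart_mul_pow y
  have hxy := fractPart_mul_pow (x + y)
  set a := (-x.valuation).toNat
  set b := (-y.valuation).toNat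
  set c := (-(x + y).valuation).toNat
  set A : ℤ := ((PadicInt.toZModPow a (scaled x)).val : ℤ)
  set B : ℤ := ((PadicInt.toZModPow b (scaled y)).val : ℤ)
  set C : ℤ := ((PadicInt.toZModPow c (scaled (x + y))).val : ℤ)
  obtain ⟨n, hn⟩ := exists_int_eq_of_norm_le_one (p := p) (m := a + b + c)
    (q := fractPart (x + y) - fractPart x - fractPart y)
    (z := C * p ^ (a + b) - A * p ^ (b + c) - B * p ^ (a + c)) (by
      push_cast
      rw [← hx, ← hy, ← hxy]
      ring) (by
      have h : ((fractPart (x + y) - fractPart x - fractPart y : ℚ) : ℚ_[p]) =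
          (x - fractPart x) + ((y - fractPart y) - ((x + y) - fractPart (x + y))) := by
        push_cast
        ring
      rw [h]
      refine (Padic.nonarchimedean _ _).trans (max_le (norm_sub_fractPart_le x) ?_)
      rw [sub_eq_add_neg (y - _)]
      refine (Padic.nonarchimedean _ _).trans (max_le (norm_sub_fractPart_le y) ?_)
      rw [norm_neg]
      exact norm_sub_fractPart_le _)
  exact ⟨n, by linarith⟩

theorem chi_add (x y : ℚ_[p]) : chi (x + y) = chi x * chi y := by
  obtain ⟨n, hn⟩ := exists_fractPart_add_eq x y
  unfold chi
  rw [hn, ← Complex.exp_add, Complex.exp_eq_exp_iff_exists_int]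
  refine ⟨n, ?_⟩
  push_cast
  ring

theorem chi_eq_one {x : ℚ_[p]} (hx : ‖x‖ ≤ 1) : chi x = 1 := by
  simp [chi, fractPart_eq_zero_of_norm_le_one hx]

theorem chi_inv_prime_ne_one : chi ((p : ℚ_[p])⁻¹) ≠ 1 := by
  have hp0 : (p : ℚ) ≠ 0 := by exact_mod_cast hp.out.ne_zero
  intro h
  unfold chi at h
  rw [Complex.exp_eq_one_iff] at h
  obtain ⟨n, hn⟩ := h
  rw [mul_comm] at hn
  have h1 : fractPart ((p : ℚ_[p])⁻¹) = n := by
    have := mul_right_cancel₀ Complex.two_pi_I_ne_zero hn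
    exact_mod_cast this
  have h2 := norm_sub_fractPart_le ((p : ℚ_[p])⁻¹)
  rw [h1] at h2
  have h3 := Padic.nonarchimedean ((p : ℚ_[p])⁻¹ - ((n : ℚ) : ℚ_[p])) ((n : ℚ) : ℚ_[p])
  rw [sub_add_cancel, norm_inv, Padic.norm_p, inv_inv] at h3
  have h4 : ‖((n : ℚ) : ℚ_[p])‖ ≤ 1 := by
    rw [Rat.cast_intCast]
    exact Padic.norm_int_le_one n
  exact absurd (h3.trans (max_le h2 h4)) (not_le.2 one_lt_cast)

/-- The Fourier transform of the indicator of a ball is a multiple of the indicator of the dual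
ball. -/
theorem integral_closedBall_chi (ξ : ℚ_[p]) (k : ℤ) :
    ∫ z in Metric.closedBall 0 ((p : ℝ) ^ k), chi (ξ * z) ∂(haar p) =
      if ‖ξ‖ ≤ (p : ℝ) ^ (-k) then (p : ℂ) ^ k else 0 := by
  have hp0 : (p : ℚ_[p]) ≠ 0 := by exact_mod_cast hp.out.ne_zero
  have hpp := cast_pos (p := p)
  split_ifs with h
  · rw [setIntegral_congr_fun (g := fun _ => (1 : ℂ)) Metric.isClosed_closedBall.measurableSet]
    · rw [setIntegral_const, haar_real_closedBall]
      simp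
    · intro z hz
      rw [mem_closedBall_iff_norm, sub_zero] at hz
      refine chi_eq_one ?_
      rw [norm_mul]
      calc _ ≤ (p : ℝ) ^ (-k) * (p : ℝ) ^ k := by gcongr
        _ = 1 := by rw [← zpow_add₀ hpp.ne']; simp
  · push Not at h
    have hξ : ξ ≠ 0 := by
      rintro rfl
      rw [norm_zero] at h
      exact absurd h (not_lt.2 (by positivity))
    set z₀ : ℚ_[p] := ξ⁻¹ * (p : ℚ_[p])⁻¹ with hz₀
    have hz₀k : ‖z₀‖ ≤ (p : ℝ) ^ k := by
      have h' : (p : ℝ) ^ (-k + 1) ≤ ‖ξ‖ := by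
        by_contra! hlt
        exact absurd ((Padic.norm_le_pow_iff_norm_lt_pow_add_one _ _).2 hlt) (not_le.2 h)
      rw [hz₀, norm_mul, norm_inv, norm_inv, Padic.norm_p, inv_inv]
      calc ‖ξ‖⁻¹ * p ≤ ((p : ℝ) ^ (-k + 1))⁻¹ * p := by gcongr
        _ = (p : ℝ) ^ k := by
          rw [← zpow_neg, ← zpow_add_one₀ hpp.ne']
          congr 1
          ring
    -- translating by `z₀` multiplies the integral by `χ(1/p) ≠ 1`
    have key : ∫ z in Metric.closedBall 0 ((p : ℝ) ^ k), chi (ξ * z) ∂(haar p) =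
        chi ((p : ℚ_[p])⁻¹) * ∫ z in Metric.closedBall 0 ((p : ℝ) ^ k), chi (ξ * z) ∂(haar p) := by
      have hmeas : MeasurableSet (Metric.closedBall (0 : ℚ_[p]) ((p : ℝ) ^ k)) :=
        Metric.isClosed_closedBall.measurableSet
      rw [← integral_indicator hmeas, ← integral_const_mul]
      conv_lhs => rw [← integral_add_left_eq_self _ z₀]
      congr 1
      ext z
      have hiff : z₀ + z ∈ Metric.closedBall (0 : ℚ_[p]) ((p : ℝ) ^ k) ↔
          z ∈ Metric.closedBall (0 : ℚ_[p]) ((p : ℝ) ^ k) := by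
        rw [← coe_ball]
        exact (Ball p k).add_mem_cancel_left hz₀k
      by_cases hz : z ∈ Metric.closedBall (0 : ℚ_[p]) ((p : ℝ) ^ k)
      · rw [Set.indicator_of_mem hz, Set.indicator_of_mem (hiff.2 hz), mul_add, chi_add]
        congr 2
        rw [hz₀, ← mul_assoc, mul_inv_cancel₀ hξ, one_mul]
      · rw [Set.indicator_of_notMem hz, Set.indicator_of_notMem (mt hiff.1 hz), mul_zero]
    by_contra hne
    exact chi_inv_prime_ne_one (mul_right_cancel₀ hne (by rw [one_mul]; exact key.symm))

/-! ### Integrals of radial functions -/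

theorem sphere_zpow (k : ℤ) : Metric.sphere (0 : ℚ_[p]) ((p : ℝ) ^ k) =
    Metric.closedBall 0 ((p : ℝ) ^ k) \ Metric.closedBall 0 ((p : ℝ) ^ (k - 1)) := by
  ext x
  simp only [Metric.mem_sphere, dist_zero_right, Set.mem_sdiff, Metric.mem_closedBall,
    Padic.norm_le_pow_iff_norm_lt_pow_add_one x (k - 1), sub_add_cancel, not_lt]
  exact ⟨fun h => ⟨h.le, h.ge⟩, fun h => le_antisymm h.1 h.2⟩

theorem measurableSet_sphere (k : ℤ) :
    MeasurableSet (Metric.sphere (0 : ℚ_[p]) ((p : ℝ) ^ k)) :=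
  Metric.isClosed_sphere.measurableSet

theorem haar_real_sphere (k : ℤ) :
    (haar p).real (Metric.sphere 0 ((p : ℝ) ^ k)) = (p : ℝ) ^ k * (1 - (p : ℝ)⁻¹) := by
  have hpp := cast_pos (p := p)
  rw [sphere_zpow, measureReal_sdiff (Metric.closedBall_subset_closedBall
      (zpow_le_zpow_right₀ one_lt_cast.le (by omega))) Metric.isClosed_closedBall.measurableSet
      (isCompact_closedBall _ _).measure_lt_top.ne,
    haar_real_closedBall, haar_real_closedBall, zpow_sub_one₀ hpp.ne']
  ring

/-- Every nonzero point of a ball lies on exactly one of the spheres of the ball. -/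
theorem iUnion_sphere (M : ℤ) :
    ⋃ n : ℕ, Metric.sphere (0 : ℚ_[p]) ((p : ℝ) ^ (M - n)) =
      Metric.closedBall 0 ((p : ℝ) ^ M) \ {0} := by
  have hpp := cast_pos (p := p)
  ext x
  simp only [Set.mem_iUnion, Metric.mem_sphere, dist_zero_right, Set.mem_sdiff,
    Metric.mem_closedBall, Set.mem_singleton_iff]
  constructor
  · rintro ⟨n, hn⟩
    refine ⟨hn.trans_le (zpow_le_zpow_right₀ one_lt_cast.le (by omega)), ?_⟩
    rintro rfl
    rw [norm_zero] at hn
    exact absurd hn (zpow_pos hpp _).ne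
  · rintro ⟨hx, hx0⟩
    rw [Padic.norm_eq_zpow_neg_valuation hx0] at hx ⊢
    have := (zpow_le_zpow_iff_right₀ (one_lt_cast (p := p))).1 hx
    exact ⟨(M + x.valuation).toNat, by congr 1; omega⟩

theorem pairwise_disjoint_sphere (M : ℤ) : Pairwise (Function.onFun Disjoint
    fun n : ℕ => Metric.sphere (0 : ℚ_[p]) ((p : ℝ) ^ (M - n))) := by
  intro i j hij
  rw [Function.onFun, Set.disjoint_left]
  intro x hx hx'
  rw [Metric.mem_sphere] at hx hx'
  have := zpow_right_injective₀ (cast_pos (p := p)) (one_lt_cast (p := p)).ne' (hx.symm.trans hx')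
  simp only [sub_right_inj, Nat.cast_inj] at this
  exact hij this

instance : (𝓝[≠] (0 : ℚ_[p])).NeBot := NormedField.nhdsNE_neBot 0

theorem setIntegral_norm_rpow (M : ℤ) {s : ℝ} (hs : 0 ≤ s) :
    ∫ ξ in Metric.closedBall 0 ((p : ℝ) ^ M), ‖ξ‖ ^ s ∂(haar p) =
      (1 - (p : ℝ)⁻¹) * ((p : ℝ) ^ M * ((p : ℝ) ^ (M * s) / (1 - (p : ℝ) ^ (-s - 1)))) := by
  have hpp := cast_pos (p := p)
  have hp1 := one_lt_cast (p := p)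
  have hint : IntegrableOn (fun ξ : ℚ_[p] => ‖ξ‖ ^ s)
      (Metric.closedBall 0 ((p : ℝ) ^ M)) (haar p) := by
    refine ContinuousOn.integrableOn_compact (isCompact_closedBall _ _) ?_
    exact (continuous_norm.rpow_const fun _ => Or.inr hs).continuousOn
  -- the origin lies on no sphere, but it is a null set
  have hae : (Metric.closedBall 0 ((p : ℝ) ^ M) \ {0} : Set ℚ_[p]) =ᵐ[haar p]
      Metric.closedBall 0 ((p : ℝ) ^ M) := sdiff_null_ae_eq_self (measure_singleton 0)
  rw [← setIntegral_congr_set hae, ← iUnion_sphere]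
  have h1 := hasSum_integral_iUnion (μ := haar p) (f := fun ξ : ℚ_[p] => ‖ξ‖ ^ s)
    (fun n : ℕ => measurableSet_sphere (M - n)) (pairwise_disjoint_sphere M)
    (by rw [iUnion_sphere]; exact hint.mono_set Set.sdiff_subset)
  refine h1.unique ?_
  have hq : (p : ℝ) ^ (-s - 1) < 1 := Real.rpow_lt_one_of_one_lt_of_neg hp1 (by linarith)
  have h2 := ((hasSum_geometric_of_lt_one (by positivity) hq).mul_left
    ((p : ℝ) ^ (M * s) * (p : ℝ) ^ M)).mul_left (1 - (p : ℝ)⁻¹)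
  rw [show (1 - (p : ℝ)⁻¹) * ((p : ℝ) ^ M * ((p : ℝ) ^ (M * s) / (1 - (p : ℝ) ^ (-s - 1)))) =
    (1 - (p : ℝ)⁻¹) * ((p : ℝ) ^ (M * s) * (p : ℝ) ^ M * (1 - (p : ℝ) ^ (-s - 1))⁻¹) by
      rw [div_eq_mul_inv]
      ring]
  convert! h2 using 1
  ext n
  rw [setIntegral_congr_fun (g := fun _ => ((p : ℝ) ^ (M - (n : ℤ))) ^ s)
    (measurableSet_sphere _), setIntegral_const, haar_real_sphere, smul_eq_mul,
    ← Real.rpow_intCast, ← Real.rpow_intCast, ← Real.rpow_mul hpp.le, ← Real.rpow_natCast,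
    ← Real.rpow_mul hpp.le]
  · have : (p : ℝ) ^ ((M : ℝ) * s) * (p : ℝ) ^ (M : ℝ) * (p : ℝ) ^ ((-s - 1) * (n : ℝ)) =
        (p : ℝ) ^ (((M - (n : ℤ) : ℤ) : ℝ)) * (p : ℝ) ^ (((M - (n : ℤ) : ℤ) : ℝ) * s) := by
      rw [← Real.rpow_add hpp, ← Real.rpow_add hpp, ← Real.rpow_add hpp]
      congr 1
      push_cast
      ring
    rw [this]
    ring
  · intro ξ hξ
    rw [Metric.mem_sphere, dist_zero_right] at hξ
    simp only [hξ]

theorem exp_neg_le_two_div_sq {x : ℝ} (hx : 0 < x) : Real.exp (-x) ≤ 2 / x ^ 2 := by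
  have := Real.pow_div_factorial_le_exp x hx.le 2
  rw [Real.exp_neg, ← one_div_div]
  rw [← one_div]
  exact one_div_le_one_div_of_le (by positivity) (by simpa using this)

/-- The sphere of radius `p ^ n` has measure at most `p ^ n`, and there the function is at most
`2 / (t p ^ n) ^ 2`, so the integrals over the spheres are dominated by a geometric series. -/
theorem integrable_exp_neg_norm_rpow {α t : ℝ} (hα : 1 ≤ α) (ht : 0 < t) :
    Integrable (fun ξ : ℚ_[p] => Real.exp (-t * ‖ξ‖ ^ α)) (haar p) := by
  have hpp := cast_pos (p := p)
  have hp1 := one_lt_cast (p := p)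
  have hloc : LocallyIntegrable (fun ξ : ℚ_[p] => Real.exp (-t * ‖ξ‖ ^ α)) (haar p) := by
    refine Continuous.locallyIntegrable ?_
    have : Continuous fun ξ : ℚ_[p] => ‖ξ‖ ^ α :=
      continuous_norm.rpow_const fun _ => Or.inr (by linarith)
    fun_prop
  have hU : (Set.univ : Set ℚ_[p]) =
      Metric.closedBall 0 1 ∪ ⋃ n : ℕ, Metric.sphere (0 : ℚ_[p]) ((p : ℝ) ^ (n : ℤ)) := by
    symm
    rw [Set.eq_univ_iff_forall]
    intro x
    by_cases hx : ‖x‖ ≤ 1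
    · left
      simpa using hx
    right
    have hx0 : x ≠ 0 := by
      rintro rfl
      simp at hx
    rw [Padic.norm_le_one_iff_val_nonneg] at hx
    rw [Set.mem_iUnion]
    refine ⟨(-x.valuation).toNat, ?_⟩
    rw [Metric.mem_sphere, dist_zero_right, Padic.norm_eq_zpow_neg_valuation hx0]
    congr 1
    omega
  rw [← integrableOn_univ, hU]
  refine (hloc.integrableOn_isCompact (isCompact_closedBall _ _)).union
    (integrableOn_iUnion_of_summable_integral_norm
      (fun n => hloc.integrableOn_isCompact (isCompact_sphere _ _)) ?_)
  have hgeo : Summable fun n : ℕ => 2 / t ^ 2 * ((p : ℝ)⁻¹) ^ n :=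
    (summable_geometric_of_lt_one (by positivity) (inv_lt_one_of_one_lt₀ hp1)).mul_left _
  refine hgeo.of_nonneg_of_le (fun n => integral_nonneg fun _ => norm_nonneg _) fun n => ?_
  have hb : ∀ ξ ∈ Metric.sphere (0 : ℚ_[p]) ((p : ℝ) ^ (n : ℤ)),
      ‖Real.exp (-t * ‖ξ‖ ^ α)‖ ≤ 2 / (t * (p : ℝ) ^ n) ^ 2 := by
    intro ξ hξ
    rw [Metric.mem_sphere, dist_zero_right, zpow_natCast] at hξ
    rw [Real.norm_of_nonneg (Real.exp_pos _).le]
    refine le_trans ?_ (exp_neg_le_two_div_sq (by positivity))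
    rw [hξ, neg_mul]
    gcongr
    nth_rw 1 [← Real.rpow_one ((p : ℝ) ^ n)]
    exact Real.rpow_le_rpow_of_exponent_le (one_le_pow₀ hp1.le) hα
  have h1 := norm_setIntegral_le_of_norm_le_const (μ := haar p)
    (isCompact_sphere (0 : ℚ_[p]) ((p : ℝ) ^ (n : ℤ))).measure_lt_top
    (f := fun ξ => ‖Real.exp (-t * ‖ξ‖ ^ α)‖) (C := 2 / (t * (p : ℝ) ^ n) ^ 2) (by
      intro ξ hξ
      rw [norm_norm]
      exact hb ξ hξ)
  rw [haar_real_sphere, Real.norm_of_nonneg (integral_nonneg fun _ => norm_nonneg _)] at h1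
  refine h1.trans ?_
  rw [zpow_natCast]
  have h2 : 2 / t ^ 2 * ((p : ℝ)⁻¹) ^ n = 2 / (t * (p : ℝ) ^ n) ^ 2 * ((p : ℝ) ^ n * 1) := by
    rw [inv_pow]
    field_simp
  rw [h2]
  gcongr
  rw [sub_le_self_iff]
  positivity

/-- The series in `c(t)` is a multiple of the termwise integral of the exponential series, so that `c(t)` brings
the total mass of `Z_N(t, ·)` to one. -/
theorem exp_mul_setIntegral_add_cFun (N : ℤ) {α : ℝ} (hα : 0 ≤ α) (t : ℝ) :
    Real.exp (lam p N α * t) * (∫ ξ in Metric.closedBall 0 ((p : ℝ) ^ (-N)),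
      Real.exp (-t * ‖ξ‖ ^ α) ∂(haar p)) + cFun p N α t = (p : ℝ) ^ (-N) := by
  have hpp := cast_pos (p := p)
  have hcont : Continuous fun ξ : ℚ_[p] => ‖ξ‖ ^ α :=
    continuous_norm.rpow_const fun _ => Or.inr hα
  have key : ∫ ξ in Metric.closedBall 0 ((p : ℝ) ^ (-N)), Real.exp (-t * ‖ξ‖ ^ α) ∂(haar p) =
      (p : ℝ) ^ (-N) * (1 - (p : ℝ)⁻¹) * ∑' n : ℕ, (-1 : ℝ) ^ n / n.factorial * t ^ n *
        ((p : ℝ) ^ (-(N : ℝ) * α * n) / (1 - (p : ℝ) ^ (-α * n - 1))) := by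
    have hexp : ∀ ξ : ℚ_[p], Real.exp (-t * ‖ξ‖ ^ α) =
        ∑' n : ℕ, (-t * ‖ξ‖ ^ α) ^ n / n.factorial := fun ξ => by
      rw [Real.exp_eq_exp_ℝ, NormedSpace.exp_eq_tsum_div]
    simp_rw [hexp]
    have hint : ∀ n : ℕ, IntegrableOn (fun ξ : ℚ_[p] => (-t * ‖ξ‖ ^ α) ^ n / n.factorial)
        (Metric.closedBall 0 ((p : ℝ) ^ (-N))) (haar p) := fun n =>
      ContinuousOn.integrableOn_compact (isCompact_closedBall _ _) (by fun_prop)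
    have hsum := hasSum_integral_of_summable_integral_norm (μ := (haar p).restrict
      (Metric.closedBall 0 ((p : ℝ) ^ (-N)))) hint (by
        have hs := (Real.summable_pow_div_factorial (|t| * ((p : ℝ) ^ (-N)) ^ α)).mul_right
          ((p : ℝ) ^ (-N))
        refine hs.of_nonneg_of_le (fun n => integral_nonneg fun _ => norm_nonneg _) fun n => ?_
        have h1 := norm_setIntegral_le_of_norm_le_const (μ := haar p)
          (isCompact_closedBall (0 : ℚ_[p]) ((p : ℝ) ^ (-N))).measure_lt_top
          (f := fun ξ => ‖(-t * ‖ξ‖ ^ α) ^ n / n.factorial‖)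
          (C := (|t| * ((p : ℝ) ^ (-N)) ^ α) ^ n / n.factorial) (by
            intro ξ hξ
            rw [mem_closedBall_zero_iff] at hξ
            rw [norm_norm, norm_div, norm_pow, norm_mul, norm_neg, Real.norm_natCast,
              Real.norm_eq_abs, Real.norm_of_nonneg (by positivity : (0 : ℝ) ≤ ‖ξ‖ ^ α)]
            gcongr)
        rwa [haar_real_closedBall,
          Real.norm_of_nonneg (integral_nonneg fun _ => norm_nonneg _)] at h1)
    rw [← hsum.tsum_eq, ← tsum_mul_left]
    congr 1
    ext n
    have h2 : ∀ ξ : ℚ_[p], (-t * ‖ξ‖ ^ α) ^ n / n.factorial =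
        (-1) ^ n / n.factorial * t ^ n * ‖ξ‖ ^ (α * n) := fun ξ => by
      rw [Real.rpow_mul (norm_nonneg _), Real.rpow_natCast, mul_pow, neg_pow]
      ring
    simp_rw [h2]
    rw [integral_const_mul, setIntegral_norm_rpow _ (by positivity)]
    push_cast
    rw [show -(N : ℝ) * (α * n) = -N * α * n by ring, show -(α * n) - 1 = -α * n - 1 by ring]
    ring
  rw [key]
  unfold cFun
  ring

/-! ### The Haar measure of the ball `B_N` -/

variable {N : ℤ}

theorem isOpenEmbedding_coe_ball : IsOpenEmbedding ((Ball p N).subtype : Ball p N → ℚ_[p]) := by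
  refine IsOpen.isOpenEmbedding_subtypeVal ?_
  have h : (Ball p N : Set ℚ_[p]) = Metric.closedBall 0 ((p : ℝ) ^ N) := coe_ball p N
  have h' : IsOpen (Ball p N : Set ℚ_[p]) := by
    rw [h]
    exact IsUltrametricDist.isOpen_closedBall _ (zpow_pos cast_pos N).ne'
  exact h'

instance : (ballMeasure p N).IsAddHaarMeasure :=
  Measure.IsAddHaarMeasure.comap (mH := inferInstance) (haar p) isOpenEmbedding_coe_ball

theorem integral_ballMeasure (f : ℚ_[p] → ℂ) :
    ∫ x, f (x : ℚ_[p]) ∂(ballMeasure p N) =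
      ∫ x in Metric.closedBall 0 ((p : ℝ) ^ N), f x ∂(haar p) := by
  rw [← coe_ball]
  exact integral_subtype_comap (measurableSet_ball p N) f

theorem ballMeasure_real_univ : (ballMeasure p N).real Set.univ = (p : ℝ) ^ N := by
  have h := integral_ballMeasure (p := p) (N := N) fun _ => 1
  rw [integral_const, setIntegral_const, haar_real_closedBall, Complex.real_smul, mul_one,
    Complex.real_smul, mul_one] at h
  exact_mod_cast h

/-! ### Convolution of functions on the ball -/

/-- The convolution `x ↦ ∫ k(x - y) u(y) dy` of two functions on `B_N`. -/
def convFun (k u : Ball p N → ℂ) (x : Ball p N) : ℂ :=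
  ∫ y, k (x - y) * u y ∂(ballMeasure p N)

theorem convFun_comm (k u : Ball p N → ℂ) : convFun k u = convFun u k := by
  ext x
  unfold convFun
  rw [← integral_sub_left_eq_self _ _ x]
  congr 1
  ext y
  rw [sub_sub_cancel, mul_comm]

theorem convFun_congr_ae (k : Ball p N → ℂ) {u v : Ball p N → ℂ} (h : u =ᵐ[ballMeasure p N] v) :
    convFun k u = convFun k v := by
  ext x
  refine integral_congr_ae ?_
  filter_upwards [h] with y hy
  rw [hy]

theorem integrable_prod_kernel {k : Ball p N → ℂ} (hk : StronglyMeasurable k)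
    (hb : ∃ C, ∀ x, ‖k x‖ ≤ C) {u : Ball p N → ℂ} (hu : Integrable u (ballMeasure p N)) :
    Integrable (fun z : Ball p N × Ball p N => k (z.1 - z.2) * u z.2)
      ((ballMeasure p N).prod (ballMeasure p N)) := by
  obtain ⟨C, hC⟩ := hb
  refine (hu.comp_snd (ballMeasure p N)).bdd_mul (c := C) ?_ (Eventually.of_forall fun z => hC _)
  exact (hk.comp_measurable (measurable_fst.sub measurable_snd)).aestronglyMeasurable

theorem convFun_assoc {h k : Ball p N → ℂ} (hh : StronglyMeasurable h)
    (hhb : ∃ C, ∀ x, ‖h x‖ ≤ C) (hk : StronglyMeasurable k) (hkb : ∃ C, ∀ x, ‖k x‖ ≤ C)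
    {u : Ball p N → ℂ} (hu : Integrable u (ballMeasure p N)) :
    convFun h (convFun k u) = convFun (convFun h k) u := by
  ext x
  have hint : Integrable (Function.uncurry fun y w : Ball p N => h (x - y) * (k (y - w) * u w))
      ((ballMeasure p N).prod (ballMeasure p N)) := by
    obtain ⟨C, hC⟩ := hhb
    refine (integrable_prod_kernel hk hkb hu).bdd_mul (c := C)
      (f := fun z : Ball p N × Ball p N => h (x - z.1)) ?_ (Eventually.of_forall fun z => hC _)
    exact (hh.comp_measurable (measurable_const.sub measurable_fst)).aestronglyMeasurable
  unfold convFun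
  simp_rw [← integral_const_mul]
  rw [integral_integral_swap hint]
  congr 1
  ext w
  simp_rw [← mul_assoc]
  rw [integral_mul_const, ← integral_add_right_eq_self _ w]
  congr 2
  ext y
  rw [add_sub_cancel_right, sub_sub, add_comm y w]

theorem coeFn_kernelOp {k : Ball p N → ℂ} (hk : StronglyMeasurable k)
    (hb : ∃ C, ∀ x, ‖k x‖ ≤ C) (u : L1 p N) :
    kernelOp k hk hb u =ᵐ[ballMeasure p N] convFun k u :=
  MemLp.coeFn_toLp (memLp_kernel hk hb u)

theorem convFun_kernelOp {h k : Ball p N → ℂ} (hh : StronglyMeasurable h)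
    (hhb : ∃ C, ∀ x, ‖h x‖ ≤ C) (hk : StronglyMeasurable k) (hkb : ∃ C, ∀ x, ‖k x‖ ≤ C)
    (u : L1 p N) : convFun h (kernelOp k hk hkb u) = convFun (convFun h k) u := by
  rw [convFun_congr_ae h (coeFn_kernelOp hk hkb u),
    convFun_assoc hh hhb hk hkb (L1.integrable_coeFn u)]

theorem norm_kernelOp_le {k : Ball p N → ℂ} (hk : StronglyMeasurable k)
    (hb : ∃ C, ∀ x, ‖k x‖ ≤ C) (u : L1 p N) :
    ‖kernelOp k hk hb u‖ ≤ (∫ x, ‖k x‖ ∂(ballMeasure p N)) * ‖u‖ := by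
  have hu := L1.integrable_coeFn u
  have hint := (integrable_prod_kernel hk hb hu).norm
  rw [L1.norm_eq_integral_norm, L1.norm_eq_integral_norm]
  calc ∫ x, ‖kernelOp k hk hb u x‖ ∂(ballMeasure p N)
      = ∫ x, ‖convFun k u x‖ ∂(ballMeasure p N) := by
        refine integral_congr_ae ?_
        filter_upwards [coeFn_kernelOp hk hb u] with x hx
        rw [hx]
    _ ≤ ∫ x, ∫ y, ‖k (x - y) * u y‖ ∂(ballMeasure p N) ∂(ballMeasure p N) := by
        refine integral_mono ?_ hint.integral_prod_left fun x => norm_integral_le_integral_norm _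
        exact ((memLp_one_iff_integrable.1 (memLp_kernel hk hb u))).norm
    _ = ∫ y, ∫ x, ‖k (x - y) * u y‖ ∂(ballMeasure p N) ∂(ballMeasure p N) :=
        integral_integral_swap hint
    _ = (∫ x, ‖k x‖ ∂(ballMeasure p N)) * ∫ x, ‖u x‖ ∂(ballMeasure p N) := by
        simp_rw [norm_mul]
        rw [← integral_const_mul]
        congr 1
        ext y
        rw [integral_mul_const, integral_sub_right_eq_self (fun x => ‖k x‖)]

/-! ### Averages over balls -/

variable (p N) in
/-- The normalised indicator function `p ^ (-k) 1_{B_k}`, as a function on `B_N`. -/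
def ballKernel (k : ℤ) (x : Ball p N) : ℂ :=
  if ‖(x : ℚ_[p])‖ ≤ (p : ℝ) ^ k then ((p : ℂ) ^ k)⁻¹ else 0

theorem isOpen_norm_le (k : ℤ) : IsOpen {x : Ball p N | ‖(x : ℚ_[p])‖ ≤ (p : ℝ) ^ k} := by
  have h : {x : Ball p N | ‖(x : ℚ_[p])‖ ≤ (p : ℝ) ^ k} =
      Subtype.val ⁻¹' Metric.closedBall (0 : ℚ_[p]) ((p : ℝ) ^ k) := by
    ext x
    simp
  rw [h]
  exact (IsUltrametricDist.isOpen_closedBall _ (zpow_pos cast_pos k).ne').preimage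
    continuous_subtype_val

theorem isLocallyConstant_ballKernel (k : ℤ) : IsLocallyConstant (ballKernel p N k) := by
  have hcl : IsClosed {x : Ball p N | ‖(x : ℚ_[p])‖ ≤ (p : ℝ) ^ k} :=
    isClosed_le (by fun_prop) continuous_const
  rw [IsLocallyConstant.iff_exists_open]
  intro x
  by_cases hx : ‖(x : ℚ_[p])‖ ≤ (p : ℝ) ^ k
  · exact ⟨_, isOpen_norm_le k, hx, fun y hy => by simp only [ballKernel, if_pos hx, if_pos hy.out]⟩
  · exact ⟨_, hcl.isOpen_compl, hx, fun y hy => by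
      have hy' : ¬ ‖(y : ℚ_[p])‖ ≤ (p : ℝ) ^ k := hy
      simp only [ballKernel, if_neg hx, if_neg hy']⟩

theorem stronglyMeasurable_ballKernel (k : ℤ) : StronglyMeasurable (ballKernel p N k) :=
  (isLocallyConstant_ballKernel k).continuous.stronglyMeasurable

theorem exists_norm_ballKernel_le (k : ℤ) : ∃ C, ∀ x, ‖ballKernel p N k x‖ ≤ C := by
  refine ⟨‖((p : ℂ) ^ k)⁻¹‖, fun x => ?_⟩
  unfold ballKernel
  split_ifs
  · exact le_rfl
  · rw [norm_zero]
    positivity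

theorem norm_sub_le_iff {k : ℤ} {x y : ℚ_[p]} (hy : ‖y‖ ≤ (p : ℝ) ^ k) :
    ‖x - y‖ ≤ (p : ℝ) ^ k ↔ ‖x‖ ≤ (p : ℝ) ^ k := by
  change x - y ∈ Ball p k ↔ x ∈ Ball p k
  rw [sub_eq_add_neg]
  exact (Ball p k).add_mem_cancel_right ((Ball p k).neg_mem hy)

/-- The kernel of a ball does not change under translation by an element of the ball. -/
theorem ballKernel_sub {k : ℤ} (x : Ball p N) {y : Ball p N}
    (hy : ‖(y : ℚ_[p])‖ ≤ (p : ℝ) ^ k) : ballKernel p N k (x - y) = ballKernel p N k x := by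
  unfold ballKernel
  rw [AddSubgroup.coe_sub]
  simp only [norm_sub_le_iff hy]

theorem integral_ballKernel_mul {k : ℤ} (hk : k ≤ N) (f : ℚ_[p] → ℂ) :
    ∫ x : Ball p N, ballKernel p N k x * f x ∂(ballMeasure p N) =
      ((p : ℂ) ^ k)⁻¹ * ∫ x in Metric.closedBall 0 ((p : ℝ) ^ k), f x ∂(haar p) := by
  have hsub : Metric.closedBall (0 : ℚ_[p]) ((p : ℝ) ^ k) ⊆
      Metric.closedBall 0 ((p : ℝ) ^ N) :=
    Metric.closedBall_subset_closedBall (zpow_le_zpow_right₀ one_lt_cast.le hk)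
  rw [← integral_const_mul]
  have h1 := integral_ballMeasure (p := p) (N := N) ((Metric.closedBall (0 : ℚ_[p])
    ((p : ℝ) ^ k)).indicator fun x => ((p : ℂ) ^ k)⁻¹ * f x)
  rw [setIntegral_indicator Metric.isClosed_closedBall.measurableSet,
    Set.inter_eq_right.2 hsub] at h1
  rw [← h1]
  congr 1
  ext x
  by_cases hx : ‖(x : ℚ_[p])‖ ≤ (p : ℝ) ^ k
  · rw [Set.indicator_of_mem (by simpa using hx), ballKernel, if_pos hx]
  · rw [Set.indicator_of_notMem (by simpa using hx), ballKernel, if_neg hx, zero_mul]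

theorem integral_ballKernel {k : ℤ} (hk : k ≤ N) :
    ∫ x, ballKernel p N k x ∂(ballMeasure p N) = 1 := by
  have h := integral_ballKernel_mul hk fun _ : ℚ_[p] => 1
  simp only [mul_one] at h
  rw [h, setIntegral_const, haar_real_closedBall]
  have : (p : ℂ) ^ k ≠ 0 := zpow_ne_zero _ (by exact_mod_cast hp.out.ne_zero)
  rw [Complex.real_smul, mul_one]
  push_cast
  exact inv_mul_cancel₀ this

theorem norm_ballKernel (k : ℤ) (x : Ball p N) :
    (‖ballKernel p N k x‖ : ℂ) = ballKernel p N k x := by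
  unfold ballKernel
  split_ifs <;> simp

theorem integral_norm_ballKernel {k : ℤ} (hk : k ≤ N) :
    ∫ x, ‖ballKernel p N k x‖ ∂(ballMeasure p N) = 1 := by
  have h := integral_ballKernel (p := p) hk
  rw [← integral_congr_ae (Eventually.of_forall (norm_ballKernel k))] at h
  rw [integral_complex_ofReal] at h
  exact_mod_cast h

/-- Averaging over a small ball and then over a larger one is averaging over the larger one. -/
theorem convFun_ballKernel_ballKernel {k l : ℤ} (hkl : k ≤ l) (hk : k ≤ N) :
    convFun (ballKernel p N l) (ballKernel p N k) = ballKernel p N l := by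
  ext x
  have h : ∀ y : Ball p N, ballKernel p N l (x - y) * ballKernel p N k y =
      ballKernel p N l x * ballKernel p N k y := by
    intro y
    by_cases hy : ‖(y : ℚ_[p])‖ ≤ (p : ℝ) ^ k
    · rw [ballKernel_sub x (hy.trans (zpow_le_zpow_right₀ one_lt_cast.le hkl))]
    · rw [show ballKernel p N k y = 0 from if_neg hy, mul_zero, mul_zero]
  unfold convFun
  simp_rw [h]
  rw [integral_const_mul, integral_ballKernel hk, mul_one]

/-- The operator on `L¹(B_N)` replacing `u` by its averages over the balls of radius `p ^ k`. -/
def averageOp (k : ℤ) : L1 p N →ₗ[ℂ] L1 p N :=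
  kernelOp (ballKernel p N k) (stronglyMeasurable_ballKernel k) (exists_norm_ballKernel_le k)

theorem norm_averageOp_le {k : ℤ} (hk : k ≤ N) (u : L1 p N) : ‖averageOp k u‖ ≤ ‖u‖ := by
  have h := norm_kernelOp_le (stronglyMeasurable_ballKernel k) (exists_norm_ballKernel_le k) u
  rwa [integral_norm_ballKernel hk, one_mul] at h

theorem norm_averageOp_toLp_sub_le {k : ℤ} (hk : k ≤ N) (f : C(Ball p N, ℂ)) {ε : ℝ}
    (hf : ∀ x y : Ball p N, ‖(y : ℚ_[p])‖ ≤ (p : ℝ) ^ k → ‖f (x - y) - f x‖ ≤ ε) :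
    ‖averageOp k (ContinuousMap.toLp 1 (ballMeasure p N) ℂ f) -
      ContinuousMap.toLp 1 (ballMeasure p N) ℂ f‖ ≤ ε * (p : ℝ) ^ N := by
  have hε : 0 ≤ ε := (norm_nonneg _).trans (hf 0 0 (by simpa using (zpow_pos cast_pos k).le))
  have hcf := ContinuousMap.coeFn_toLp (𝕜 := ℂ) (p := 1) (ballMeasure p N) f
  rw [L1.norm_eq_integral_norm, ← ballMeasure_real_univ]
  refine (Real.norm_of_nonneg (integral_nonneg fun _ => norm_nonneg _)).symm.trans_le
    (norm_integral_le_of_norm_le_const ?_)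
  have hpt : ∀ x, ‖convFun (ballKernel p N k) f x - f x‖ ≤ ε := by
    intro x
    have hi : ∀ g : C(Ball p N, ℂ),
        Integrable (fun y => g y * ballKernel p N k y) (ballMeasure p N) := fun g =>
      (g.continuous.mul (isLocallyConstant_ballKernel k).continuous).integrable_of_hasCompactSupport
        (HasCompactSupport.of_compactSpace _)
    have h1 : convFun (ballKernel p N k) f x - f x =
        ∫ y, (f (x - y) - f x) * ballKernel p N k y ∂(ballMeasure p N) := by
      simp_rw [sub_mul]
      have hi₁ : Integrable (fun y => f (x - y) * ballKernel p N k y) (ballMeasure p N) :=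
        hi ⟨fun y => f (x - y), by fun_prop⟩
      have hi₂ : Integrable (fun y => f x * ballKernel p N k y) (ballMeasure p N) :=
        hi (ContinuousMap.const _ (f x))
      rw [integral_sub hi₁ hi₂, convFun_comm, integral_const_mul, integral_ballKernel hk, mul_one]
      rfl
    rw [h1]
    have hn : Integrable (fun y => ε * ‖ballKernel p N k y‖) (ballMeasure p N) := by
      have := (hi (ContinuousMap.const _ 1)).norm.const_mul ε
      simpa using this
    refine (norm_integral_le_of_norm_le hn (Eventually.of_forall fun y => ?_)).trans_eq
      (by rw [integral_const_mul, integral_norm_ballKernel hk, mul_one])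
    rw [norm_mul]
    by_cases hy : ‖(y : ℚ_[p])‖ ≤ (p : ℝ) ^ k
    · exact mul_le_mul_of_nonneg_right (hf x y hy) (norm_nonneg _)
    · rw [show ballKernel p N k y = 0 from if_neg hy, norm_zero, mul_zero, mul_zero]
  filter_upwards [hcf, coeFn_kernelOp (stronglyMeasurable_ballKernel k)
    (exists_norm_ballKernel_le k) (ContinuousMap.toLp 1 (ballMeasure p N) ℂ f),
    Lp.coeFn_sub (averageOp k (ContinuousMap.toLp 1 (ballMeasure p N) ℂ f))
      (ContinuousMap.toLp 1 (ballMeasure p N) ℂ f)] with x h1 h2 h3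
  rw [norm_norm, h3, Pi.sub_apply, h1]
  unfold averageOp
  rw [h2, convFun_congr_ae _ hcf]
  exact hpt x

/-- The averages over shrinking balls converge to the function, in `L¹(B_N)`. -/
theorem tendsto_averageOp (u : L1 p N) :
    Tendsto (fun n : ℕ => averageOp (N - n) u) atTop (𝓝 u) := by
  have hpp := cast_pos (p := p)
  rw [Metric.tendsto_atTop]
  intro ε hε
  obtain ⟨f, hf⟩ := (ContinuousMap.toLp_denseRange ℂ (ballMeasure p N) ℂ
    (p := 1) ENNReal.one_ne_top).exists_dist_lt u (show 0 < ε / 3 by linarith)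
  set w : L1 p N := ContinuousMap.toLp 1 (ballMeasure p N) ℂ f with hw
  have huc := CompactSpace.uniformContinuous_of_continuous f.continuous
  obtain ⟨δ, hδ, hfδ⟩ := Metric.uniformContinuous_iff.1 huc (ε / 4 / (p : ℝ) ^ N)
    (by positivity)
  have hlim : Tendsto (fun n : ℕ => (p : ℝ) ^ (N - n)) atTop (𝓝 0) := by
    have h := (tendsto_pow_atTop_nhds_zero_of_lt_one (by positivity)
      (inv_lt_one_of_one_lt₀ (one_lt_cast (p := p)))).const_mul ((p : ℝ) ^ N)
    rw [mul_zero] at h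
    refine h.congr fun n => ?_
    rw [zpow_sub₀ hpp.ne', zpow_natCast, inv_pow, div_eq_mul_inv]
  obtain ⟨n₀, hn₀⟩ := eventually_atTop.1 (hlim.eventually (gt_mem_nhds hδ))
  refine ⟨n₀, fun n hn => ?_⟩
  have hnN : N - (n : ℤ) ≤ N := by omega
  have h1 := norm_averageOp_toLp_sub_le hnN f (ε := ε / 4 / (p : ℝ) ^ N) fun x y hy => by
    rw [← dist_eq_norm]
    refine (hfδ ?_).le
    rw [Subtype.dist_eq, AddSubgroup.coe_sub, dist_eq_norm, sub_sub_cancel_left, norm_neg]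
    exact hy.trans_lt (hn₀ n hn)
  rw [div_mul_cancel₀ _ (by positivity)] at h1
  have h2 := norm_averageOp_le hnN (u - w)
  rw [dist_eq_norm] at hf ⊢
  have h3 : averageOp (N - n) u - u =
      averageOp (N - n) (u - w) + (averageOp (N - n) w - w) - (u - w) := by
    rw [map_sub]
    abel
  rw [h3]
  refine (norm_sub_le _ _).trans_lt ?_
  have := norm_add_le (averageOp (N - n) (u - w)) (averageOp (N - n) w - w)
  linarith

/-! ### Averages of the heat kernel -/

/-- Averaging the heat kernel over a ball cuts its Fourier transform off outside the dual ball. -/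
theorem average_heatKernel {α t : ℝ} (hα : 1 ≤ α) (ht : 0 < t) (l : ℤ) (x : ℚ_[p]) :
    ((p : ℂ) ^ l)⁻¹ * ∫ y in Metric.closedBall 0 ((p : ℝ) ^ l), heatKernel α t (x - y) ∂(haar p) =
      ∫ ξ in Metric.closedBall 0 ((p : ℝ) ^ (-l)),
        chi (ξ * x) * (Real.exp (-t * ‖ξ‖ ^ α) : ℂ) ∂(haar p) := by
  have hp0 : (p : ℂ) ^ l ≠ 0 := zpow_ne_zero _ (by exact_mod_cast hp.out.ne_zero)
  have hfin : IsFiniteMeasure ((haar p).restrict (Metric.closedBall 0 ((p : ℝ) ^ l))) :=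
    ⟨by rw [Measure.restrict_apply_univ]; exact (isCompact_closedBall _ _).measure_lt_top⟩
  have hint : Integrable (Function.uncurry fun y ξ : ℚ_[p] =>
      chi (ξ * (x - y)) * (Real.exp (-t * ‖ξ‖ ^ α) : ℂ))
      (((haar p).restrict (Metric.closedBall 0 ((p : ℝ) ^ l))).prod (haar p)) := by
    have h1 : Integrable (fun ξ : ℚ_[p] => (Real.exp (-t * ‖ξ‖ ^ α) : ℂ)) (haar p) :=
      (integrable_exp_neg_norm_rpow hα ht).ofReal
    refine (h1.comp_snd ((haar p).restrict (Metric.closedBall 0 ((p : ℝ) ^ l)))).bdd_mul (c := 1)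
      (f := fun z : ℚ_[p] × ℚ_[p] => chi (z.2 * (x - z.1))) ?_
      (Eventually.of_forall fun z => (norm_chi _).le)
    exact (measurable_chi.comp (measurable_snd.mul
      (measurable_const.sub measurable_fst))).aestronglyMeasurable
  unfold heatKernel
  rw [integral_integral_swap hint, ← integral_const_mul,
    ← integral_indicator Metric.isClosed_closedBall.measurableSet]
  congr 1
  ext ξ
  have h2 : ∀ y : ℚ_[p], chi (ξ * (x - y)) * (Real.exp (-t * ‖ξ‖ ^ α) : ℂ) =
      chi (ξ * x) * (Real.exp (-t * ‖ξ‖ ^ α) : ℂ) * chi (-ξ * y) := by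
    intro y
    rw [show ξ * (x - y) = ξ * x + -ξ * y by ring, chi_add]
    ring
  simp_rw [h2]
  rw [integral_const_mul, integral_closedBall_chi, norm_neg]
  by_cases hξ : ‖ξ‖ ≤ (p : ℝ) ^ (-l)
  · rw [if_pos hξ, Set.indicator_of_mem (by simpa using hξ), mul_comm, mul_assoc,
      mul_inv_cancel₀ hp0, mul_one]
  · rw [if_neg hξ, Set.indicator_of_notMem (by simpa using hξ), mul_zero, mul_zero]

theorem integrable_chi_mul_exp {α t : ℝ} (hα : 1 ≤ α) (ht : 0 < t) (x : ℚ_[p]) :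
    Integrable (fun ξ : ℚ_[p] => chi (ξ * x) * (Real.exp (-t * ‖ξ‖ ^ α) : ℂ)) (haar p) :=
  (integrable_exp_neg_norm_rpow hα ht).ofReal.bdd_mul (c := 1)
    (measurable_chi.comp (measurable_id.mul_const x)).aestronglyMeasurable
    (Eventually.of_forall fun _ => (norm_chi _).le)

theorem convFun_ballKernel_ballHeatKernel {α t : ℝ} (hα : 1 ≤ α) (ht : 0 < t) {l : ℤ}
    (hl : l ≤ N) (x : Ball p N) :
    convFun (ballKernel p N l) (ballHeatKernel p N α t) x =
      (Real.exp (lam p N α * t) : ℂ) * (∫ ξ in Metric.closedBall 0 ((p : ℝ) ^ (-l)),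
        chi (ξ * (x : ℚ_[p])) * (Real.exp (-t * ‖ξ‖ ^ α) : ℂ) ∂(haar p)) +
          (cFun p N α t : ℂ) := by
  rw [convFun_comm, ← average_heatKernel hα ht, ← integral_ballKernel_mul hl
    (fun y => heatKernel α t ((x : ℚ_[p]) - y)), ← integral_const_mul]
  have h1 : Integrable (fun y => ballHeatKernel p N α t (x - y) * ballKernel p N l y)
      (ballMeasure p N) := by
    obtain ⟨C, hC⟩ := exists_norm_ballHeatKernel_le p N α t
    refine Integrable.bdd_mul (c := C) ?_ ?_ (Eventually.of_forall fun y => hC _)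
    · exact (isLocallyConstant_ballKernel l).continuous.integrable_of_hasCompactSupport
        (HasCompactSupport.of_compactSpace _)
    · exact ((stronglyMeasurable_ballHeatKernel p N α t).comp_measurable
        (measurable_const.sub measurable_id)).aestronglyMeasurable
  have h2 : Integrable (fun y => (cFun p N α t : ℂ) * ballKernel p N l y) (ballMeasure p N) :=
    ((isLocallyConstant_ballKernel l).continuous.integrable_of_hasCompactSupport
        (HasCompactSupport.of_compactSpace _)).const_mul _
  have h3 : (cFun p N α t : ℂ) = ∫ y, (cFun p N α t : ℂ) * ballKernel p N l y
      ∂(ballMeasure p N) := by rw [integral_const_mul, integral_ballKernel hl, mul_one]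
  conv_rhs => rw [h3]
  unfold convFun
  rw [← sub_eq_iff_eq_add, ← integral_sub h1 h2]
  congr 1
  ext y
  simp only [ballHeatKernel, AddSubgroup.coe_sub]
  ring

/-- `Z_N(t, ·)` has total mass one. -/
theorem convFun_ballKernel_ballHeatKernel_top {α t : ℝ} (hα : 1 ≤ α) (ht : 0 < t) :
    convFun (ballKernel p N N) (ballHeatKernel p N α t) = ballKernel p N N := by
  ext x
  rw [convFun_ballKernel_ballHeatKernel hα ht le_rfl,
    setIntegral_congr_fun (g := fun ξ => (Real.exp (-t * ‖ξ‖ ^ α) : ℂ))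
      Metric.isClosed_closedBall.measurableSet, integral_complex_ofReal, ballKernel,
    if_pos (show ‖(x : ℚ_[p])‖ ≤ _ from x.2)]
  · have h := exp_mul_setIntegral_add_cFun (p := p) N (by linarith : 0 ≤ α) t
    have h' := congrArg (fun r : ℝ => (r : ℂ)) h
    push_cast at h' ⊢
    rw [← zpow_neg]
    exact h'
  · intro ξ hξ
    rw [mem_closedBall_zero_iff] at hξ
    have h1 : ‖ξ * x‖ ≤ 1 := by
      rw [norm_mul]
      calc _ ≤ (p : ℝ) ^ (-N) * (p : ℝ) ^ N :=
            mul_le_mul hξ x.2 (norm_nonneg _) (zpow_pos cast_pos _).le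
        _ = 1 := by rw [← zpow_add₀ cast_pos.ne']; simp
    simp only [chi_eq_one h1, one_mul]

theorem rpow_zpow (k : ℤ) (s : ℝ) : ((p : ℝ) ^ k) ^ s = (p : ℝ) ^ (k * s) := by
  rw [← Real.rpow_intCast, ← Real.rpow_mul cast_pos.le]

/-- On the functions constant on the cosets of `B_l` with zero averages over the cosets of
`B_{l+1}`, convolution with `Z_N(t, ·)` is multiplication by a number, the Fourier transform of
`Z_N(t, ·)` being constant on the sphere of radius `p ^ (-l)`. -/
theorem convFun_ballKernel_sub_ballHeatKernel {α t : ℝ} (hα : 1 ≤ α) (ht : 0 < t) {l : ℤ}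
    (hl : l + 1 ≤ N) (x : Ball p N) :
    convFun (ballKernel p N l) (ballHeatKernel p N α t) x -
        convFun (ballKernel p N (l + 1)) (ballHeatKernel p N α t) x =
      (Real.exp (-(t * ((p : ℝ) ^ (-l * α) - lam p N α))) : ℂ) *
        (ballKernel p N l x - ballKernel p N (l + 1) x) := by
  have hsub : Metric.closedBall (0 : ℚ_[p]) ((p : ℝ) ^ (-(l + 1))) ⊆
      Metric.closedBall 0 ((p : ℝ) ^ (-l)) :=
    Metric.closedBall_subset_closedBall (zpow_le_zpow_right₀ one_lt_cast.le (by omega))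
  have hsph : Metric.closedBall (0 : ℚ_[p]) ((p : ℝ) ^ (-l)) \
      Metric.closedBall 0 ((p : ℝ) ^ (-(l + 1))) = Metric.sphere 0 ((p : ℝ) ^ (-l)) := by
    rw [sphere_zpow]
    congr 3
    ring
  have hdiff : ∀ f : ℚ_[p] → ℂ, LocallyIntegrable f (haar p) →
      (∫ ξ in Metric.closedBall 0 ((p : ℝ) ^ (-l)), f ξ ∂(haar p)) -
        ∫ ξ in Metric.closedBall 0 ((p : ℝ) ^ (-(l + 1))), f ξ ∂(haar p) =
      ∫ ξ in Metric.sphere 0 ((p : ℝ) ^ (-l)), f ξ ∂(haar p) := by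
    intro f hf
    rw [← hsph, ← integral_inter_add_sdiff Metric.isClosed_closedBall.measurableSet
      (hf.integrableOn_isCompact (isCompact_closedBall 0 ((p : ℝ) ^ (-l)))),
      Set.inter_eq_right.2 hsub, add_sub_cancel_left]
  have hchi : ∀ k : ℤ, ∫ ξ in Metric.closedBall 0 ((p : ℝ) ^ (-k)), chi (ξ * (x : ℚ_[p]))
      ∂(haar p) = ballKernel p N k x := by
    intro k
    have h := integral_closedBall_chi (x : ℚ_[p]) (-k)
    simp_rw [mul_comm (x : ℚ_[p])] at h
    rw [h, ballKernel, neg_neg, zpow_neg]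
  have hloc : LocallyIntegrable (fun ξ : ℚ_[p] => chi (ξ * (x : ℚ_[p]))) (haar p) := by
    refine (locallyIntegrable_const (1 : ℂ)).mono
      (measurable_chi.comp (measurable_id.mul_const _)).aestronglyMeasurable
      (Eventually.of_forall fun ξ => ?_)
    rw [norm_chi, norm_one]
  rw [convFun_ballKernel_ballHeatKernel hα ht (by omega : l ≤ N),
    convFun_ballKernel_ballHeatKernel hα ht hl, add_sub_add_right_eq_sub, ← mul_sub,
    hdiff _ (integrable_chi_mul_exp hα ht _).locallyIntegrable, ← hchi, ← hchi, hdiff _ hloc,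
    setIntegral_congr_fun (g := fun ξ => chi (ξ * (x : ℚ_[p])) *
      (Real.exp (-t * (p : ℝ) ^ (-l * α)) : ℂ)) (measurableSet_sphere _), integral_mul_const,
    mul_comm (∫ _ in _, _ ∂_), ← mul_assoc, ← Complex.ofReal_mul, ← Real.exp_add]
  · congr 4
    ring
  · intro ξ hξ
    rw [mem_sphere_zero_iff_norm] at hξ
    simp only [hξ, rpow_zpow]
    push_cast
    rfl

/-! ### Pairing with test functions -/

/-- The pairing `u ↦ ⟨u, φ⟩` with a test function, as a continuous functional on `L¹(B_N)`. -/
def pairing (φ : TestFunction p N) : L1 p N →L[ℂ] ℂ :=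
  LinearMap.mkContinuousOfExistsBound
    { toFun := fun u => ofL1 u φ
      map_add' := fun u v => by
        have hint : ∀ u : L1 p N, Integrable (fun x => u x * φ x) (ballMeasure p N) := fun u =>  by
          obtain ⟨C, hC⟩ := (isCompact_range φ.continuous).isBounded.exists_norm_le
          exact (L1.integrable_coeFn u).mul_bdd (c := C) φ.continuous.aestronglyMeasurable
            (Eventually.of_forall fun x => hC _ ⟨x, rfl⟩)
        refine Eq.trans ?_ (integral_add (hint u) (hint v))
        refine integral_congr_ae ?_
        filter_upwards [Lp.coeFn_add u v] with x hx
        rw [hx, Pi.add_apply, add_mul]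
      map_smul' := fun c u => by
        refine Eq.trans ?_ (integral_const_mul c _)
        refine integral_congr_ae ?_
        filter_upwards [Lp.coeFn_smul c u] with x hx
        rw [hx, Pi.smul_apply, smul_eq_mul, mul_assoc] }
    (by
      obtain ⟨C, hC⟩ := (isCompact_range φ.continuous).isBounded.exists_norm_le
      refine ⟨C, fun u => ?_⟩
      rw [L1.norm_eq_integral_norm, ← integral_const_mul]
      refine norm_integral_le_of_norm_le ((L1.integrable_coeFn u).norm.const_mul C)
        (Eventually.of_forall fun x => ?_)
      rw [norm_mul, mul_comm]
      exact mul_le_mul_of_nonneg_right (hC _ ⟨x, rfl⟩) (norm_nonneg _))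

theorem ofL1_add (u v : L1 p N) : ofL1 (u + v) = ofL1 u + ofL1 v := by
  ext φ
  exact map_add (pairing φ) u v

theorem ofL1_smul (c : ℂ) (u : L1 p N) : ofL1 (c • u) = c • ofL1 u := by
  ext φ
  exact map_smul (pairing φ) c u

/-- The test function `y ↦ p ^ (-k) 1_{B_k}(x - y)`. -/
def averageTest (k : ℤ) (x : Ball p N) : TestFunction p N :=
  ⟨fun y => ballKernel p N k (x - y),
    (isLocallyConstant_ballKernel k).comp_continuous (continuous_const.sub continuous_id)⟩

theorem ofL1_averageTest (u : L1 p N) (k : ℤ) (x : Ball p N) :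
    ofL1 u (averageTest k x) = convFun (ballKernel p N k) u x := by
  unfold convFun
  simp_rw [mul_comm (ballKernel p N k _)]
  rfl

/-- Each test function is a finite linear combination of normalised indicators of balls of some
common radius. -/
theorem distribution_ext {f g : Distribution p N}
    (h : ∀ (n : ℕ) (x : Ball p N), f (averageTest (N - n) x) = g (averageTest (N - n) x)) :
    f = g := by
  have hpp := cast_pos (p := p)
  refine LinearMap.ext fun φ => ?_
  obtain ⟨δ, hδ, hφ⟩ := exists_forall_dist_lt φ
  obtain ⟨n, hn⟩ : ∃ n : ℕ, (p : ℝ) ^ (N - n) < δ := by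
    obtain ⟨n, hn⟩ := exists_pow_lt_of_lt_one (show 0 < δ / (p : ℝ) ^ N by positivity)
      (inv_lt_one_of_one_lt₀ (one_lt_cast (p := p)))
    refine ⟨n, ?_⟩
    rw [lt_div_iff₀ (by positivity)] at hn
    rw [zpow_sub₀ hpp.ne', zpow_natCast, div_eq_inv_mul, ← inv_pow]
    exact hn
  set k : ℤ := N - n with hk
  set U : AddSubgroup (Ball p N) := (Ball p k).addSubgroupOf (Ball p N) with hU
  have hUo : IsOpen (U : Set (Ball p N)) := isOpen_norm_le k
  have hfinite : Finite (Ball p N ⧸ U) := U.quotient_finite_of_isOpen hUo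
  let _ : Fintype (Ball p N ⧸ U) := Fintype.ofFinite _
  have hpk : (p : ℂ) ^ k ≠ 0 := zpow_ne_zero _ (by exact_mod_cast hp.out.ne_zero)
  have hsum : φ = ∑ q : Ball p N ⧸ U, (φ q.out * (p : ℂ) ^ k) • averageTest k q.out := by
    ext y
    have happ : (∑ q : Ball p N ⧸ U, (φ q.out * (p : ℂ) ^ k) • averageTest k q.out) y =
        ∑ q : Ball p N ⧸ U, (φ q.out * (p : ℂ) ^ k) * ballKernel p N k (q.out - y) :=
      map_sum (LocallyConstant.evalₗ ℂ y) _ _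
    have hmem : ∀ q : Ball p N ⧸ U,
        ‖((q.out - y : Ball p N) : ℚ_[p])‖ ≤ (p : ℝ) ^ k ↔ (y : Ball p N ⧸ U) = q := by
      intro q
      conv_rhs => rw [← QuotientAddGroup.out_eq' q, QuotientAddGroup.eq]
      rw [add_comm, ← sub_eq_add_neg]
      rfl
    rw [happ, Finset.sum_eq_single (y : Ball p N ⧸ U)]
    · have h1 := (hmem _).2 rfl
      rw [ballKernel, if_pos h1, mul_assoc, mul_inv_cancel₀ hpk, mul_one]
      refine hφ _ _ ?_
      rw [dist_comm, Subtype.dist_eq, dist_eq_norm]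
      exact h1.trans_lt hn
    · intro q _ hq
      rw [ballKernel, if_neg (mt (hmem q).1 hq.symm), mul_zero]
    · exact fun hq => absurd (Finset.mem_univ _) hq
  rw [hsum, map_sum, map_sum]
  refine Finset.sum_congr rfl fun q _ => ?_
  rw [map_smul, map_smul, h]

/-! ### The Riesz distribution through averages over balls -/

theorem lam_eq (N : ℤ) (α : ℝ) : lam p N α =
    (1 - (p : ℝ)⁻¹) / (1 - (p : ℝ) ^ (-α - 1)) * (p : ℝ) ^ (-α * N) := by
  have hpp := cast_pos (p := p)
  unfold lam
  have h1 : (p : ℝ) ^ (α * (1 - N)) = (p : ℝ) ^ α * (p : ℝ) ^ (-α * N) := by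
    rw [← Real.rpow_add hpp]
    congr 1
    ring
  have h2 : (p : ℝ) ^ (-α - 1) = ((p : ℝ) ^ (α + 1))⁻¹ := by
    rw [← Real.rpow_neg hpp.le]
    congr 1
    ring
  have h3 : (p : ℝ) ^ (α + 1) = (p : ℝ) ^ α * p := by rw [Real.rpow_add hpp, Real.rpow_one]
  have h4 : (p : ℝ) ^ (α + 1) ≠ 0 := (Real.rpow_pos_of_pos hpp _).ne'
  rw [h1, h2, ← mul_assoc]
  congr 1
  have h5 : 1 - ((p : ℝ) ^ (α + 1))⁻¹ = ((p : ℝ) ^ (α + 1) - 1) / (p : ℝ) ^ (α + 1) := by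
    field_simp
  rw [h5, div_div_eq_mul_div, div_mul_eq_mul_div]
  congr 1
  rw [h3]
  field_simp

/-- The eigenvalues of the generator are positive. -/
theorem lam_lt {α : ℝ} (hα : 0 < α) : lam p N α < (p : ℝ) ^ (-N * α) := by
  have hpp := cast_pos (p := p)
  have hp1 := one_lt_cast (p := p)
  rw [lam_eq, show -α * (N : ℝ) = -N * α by ring]
  refine mul_lt_of_lt_one_left (Real.rpow_pos_of_pos hpp _) ?_
  have h : (p : ℝ) ^ (-α - 1) < (p : ℝ)⁻¹ := by
    rw [← Real.rpow_neg_one]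
    exact Real.rpow_lt_rpow_of_exponent_lt hp1 (by linarith)
  have h' := inv_lt_one_of_one_lt₀ hp1
  rw [div_lt_one (by linarith)]
  linarith

/-- Summation by parts, converting the regularised integral over a ball, cut into spheres, into
a combination of differences of averages. -/
theorem sum_regularized_eq (α : ℝ) (hα : 0 < α) (k : ℤ) (G : ℕ → ℂ) (n : ℕ) :
    (((1 - (p : ℝ)⁻¹) / (1 - (p : ℝ) ^ (-α - 1)) * (p : ℝ) ^ (-α * (k + n : ℤ)) : ℝ) : ℂ) * G 0 +
      (((1 - (p : ℝ) ^ α) / (1 - (p : ℝ) ^ (-α - 1)) : ℝ) : ℂ) *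
        ∑ j ∈ Finset.range n, (((p : ℝ) ^ (k + j + 1)) ^ (-α - 1) : ℝ) *
          ((p : ℂ) ^ (k + j + 1) * (G (j + 1) - G 0) - (p : ℂ) ^ (k + j) * (G j - G 0)) =
    (((1 - (p : ℝ)⁻¹) / (1 - (p : ℝ) ^ (-α - 1)) * (p : ℝ) ^ (-α * (k + n : ℤ)) : ℝ) : ℂ) * G n +
      ∑ j ∈ Finset.range n, ((p : ℝ) ^ (-(k + j : ℤ) * α) : ℝ) * (G j - G (j + 1)) := by
  have hpp := cast_pos (p := p)
  have hp1 := one_lt_cast (p := p)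
  have hD : (p : ℝ) ^ (-α - 1) < 1 := Real.rpow_lt_one_of_one_lt_of_neg hp1 (by linarith)
  -- in the induction step everything is a rational function of `a = p ^ (-α (k + n))`,
  -- `b = p ^ (-α)` and `c = p ^ (k + n)`
  induction n with
  | zero => simp
  | succ n ih =>
    rw [Finset.sum_range_succ, Finset.sum_range_succ]
    have e1 : (p : ℝ) ^ (-α * ((k + (n + 1 : ℕ) : ℤ) : ℝ)) =
        (p : ℝ) ^ (-α * ((k + n : ℤ) : ℝ)) * (p : ℝ) ^ (-α) := by
      rw [← Real.rpow_add hpp]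
      congr 1
      push_cast
      ring
    have e2 : ((p : ℝ) ^ (k + n + 1)) ^ (-α - 1) =
        (p : ℝ) ^ (-α * ((k + n : ℤ) : ℝ)) * (p : ℝ) ^ (-α) * ((p : ℝ) ^ (k + n) * p)⁻¹ := by
      rw [rpow_zpow, ← Real.rpow_add hpp, ← zpow_add_one₀ hpp.ne', ← Real.rpow_intCast,
        ← Real.rpow_neg hpp.le, ← Real.rpow_add hpp]
      congr 1
      push_cast
      ring
    have e3 : (p : ℝ) ^ (-α - 1) = (p : ℝ) ^ (-α) * (p : ℝ)⁻¹ := by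
      rw [← Real.rpow_neg_one, ← Real.rpow_add hpp]
      rfl
    have e4 : (p : ℝ) ^ (-((k + n : ℤ) : ℝ) * α) = (p : ℝ) ^ (-α * ((k + n : ℤ) : ℝ)) := by
      congr 1
      ring
    have e5 : (p : ℝ) ^ α = ((p : ℝ) ^ (-α))⁻¹ := by
      rw [← Real.rpow_neg hpp.le, neg_neg]
    have e6 : (p : ℂ) ^ (k + n + 1) = (p : ℂ) ^ (k + n) * p :=
      zpow_add_one₀ (by exact_mod_cast hp.out.ne_zero) _
    have e7 : (p : ℂ) ^ (k + n : ℤ) ≠ 0 := zpow_ne_zero _ (by exact_mod_cast hp.out.ne_zero)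
    have e8 : (p : ℂ) ≠ 0 := by exact_mod_cast hp.out.ne_zero
    rw [e1, e2, e4, e6]
    rw [e3, e5] at ih ⊢
    rw [e3] at hD
    have hb : (((p : ℝ) ^ (-α) : ℝ) : ℂ) ≠ 0 := by
      exact_mod_cast (Real.rpow_pos_of_pos hpp _).ne'
    have hD' : (p : ℂ) - (((p : ℝ) ^ (-α) : ℝ) : ℂ) ≠ 0 := by
      have : (p : ℝ) - (p : ℝ) ^ (-α) ≠ 0 := by
        rw [← div_eq_mul_inv, div_lt_one hpp] at hD
        linarith
      exact_mod_cast this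
    generalize (p : ℝ) ^ (-α * ((k + n : ℤ) : ℝ)) = a at *
    generalize (p : ℝ) ^ (-α) = b at *
    generalize ∑ j ∈ Finset.range n, (((p : ℝ) ^ (k + j + 1)) ^ (-α - 1) : ℝ) *
          ((p : ℂ) ^ (k + j + 1) * (G (j + 1) - G 0) - (p : ℂ) ^ (k + j) * (G j - G 0)) = S at *
    generalize ∑ j ∈ Finset.range n, (((p : ℝ) ^ (-(k + j : ℤ) * α) : ℝ) : ℂ) *
      (G j - G (j + 1)) = S' at *
    rw [← sub_eq_iff_eq_add'] at ih
    rw [← ih, mul_add]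
    push_cast
    generalize (p : ℂ) ^ (k + n : ℤ) = c at *
    have hD2 : (1 : ℂ) - b * (p : ℂ)⁻¹ ≠ 0 := by
      rw [← div_eq_mul_inv, one_sub_div e8]
      exact div_ne_zero hD' e8
    field_simp
    ring

theorem zpow_mul_ballKernel (l : ℤ) (x : Ball p N) :
    (p : ℂ) ^ l * ballKernel p N l x = if ‖(x : ℚ_[p])‖ ≤ (p : ℝ) ^ l then 1 else 0 := by
  have h : (p : ℂ) ^ l ≠ 0 := zpow_ne_zero _ (by exact_mod_cast hp.out.ne_zero)
  unfold ballKernel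
  split_ifs
  · exact mul_inv_cancel₀ h
  · exact mul_zero _

theorem integrable_ballKernel_mul (l : ℤ) {f : Ball p N → ℂ}
    (hf : Integrable f (ballMeasure p N)) :
    Integrable (fun x => ballKernel p N l x * f x) (ballMeasure p N) := by
  obtain ⟨C, hC⟩ := exists_norm_ballKernel_le (p := p) (N := N) l
  exact hf.bdd_mul (stronglyMeasurable_ballKernel l).aestronglyMeasurable
    (Eventually.of_forall hC)

theorem integrable_testFunction (φ : TestFunction p N) : Integrable φ (ballMeasure p N) :=
  φ.continuous.integrable_of_hasCompactSupport (HasCompactSupport.of_compactSpace _)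

/-- The regularised integral of a test function over a ball, cut into spheres. -/
theorem integral_regularized_eq_sum (s : ℝ) (k : ℤ) (n : ℕ) (hN : k + n ≤ N)
    (g : TestFunction p N) (hg : ∀ x : Ball p N, ‖(x : ℚ_[p])‖ ≤ (p : ℝ) ^ k → g x = g 0) :
    ∫ x, (p : ℂ) ^ (k + n) * (ballKernel p N (k + n) x *
        ((g x - g 0) * ((‖(x : ℚ_[p])‖ ^ s : ℝ) : ℂ))) ∂(ballMeasure p N) =
      ∑ j ∈ Finset.range n, (((p : ℝ) ^ (k + j + 1)) ^ s : ℝ) *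
        ((p : ℂ) ^ (k + j + 1) * ((∫ x, ballKernel p N (k + j + 1) x * g x ∂(ballMeasure p N)) -
            g 0) -
          (p : ℂ) ^ (k + j) * ((∫ x, ballKernel p N (k + j) x * g x ∂(ballMeasure p N)) -
            g 0)) := by
  induction n with
  | zero =>
    rw [Finset.sum_range_zero]
    refine integral_eq_zero_of_ae (Eventually.of_forall fun x => ?_)
    by_cases hx : ‖(x : ℚ_[p])‖ ≤ (p : ℝ) ^ k
    · simp [hg x hx]
    · simp [ballKernel, hx]
  | succ n ih =>
    rw [Finset.sum_range_succ, ← ih (by push_cast at hN; omega)]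
    have hint : ∀ l ≤ N, ∫ x, ballKernel p N l x * (g x - g 0) ∂(ballMeasure p N) =
        (∫ x, ballKernel p N l x * g x ∂(ballMeasure p N)) - g 0 := by
      intro l hl
      simp_rw [mul_sub]
      rw [integral_sub (integrable_ballKernel_mul l (integrable_testFunction g))
        (integrable_ballKernel_mul l (integrable_const _)), integral_mul_const,
        integral_ballKernel hl, one_mul]
    have hreg : ∀ l, Integrable (fun x => (p : ℂ) ^ l * (ballKernel p N l x *
        ((g x - g 0) * ((‖(x : ℚ_[p])‖ ^ s : ℝ) : ℂ)))) (ballMeasure p N) := fun l =>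
      (integrable_ballKernel_mul l (integrable_regularized s g)).const_mul _
    have hdif : ∀ l, Integrable (fun x => (p : ℂ) ^ l * (ballKernel p N l x * (g x - g 0)))
        (ballMeasure p N) := fun l =>
      (integrable_ballKernel_mul l ((integrable_testFunction g).sub
        (integrable_const _))).const_mul _
    rw [← hint _ (by push_cast at hN; omega), ← hint _ (by push_cast at hN; omega),
      ← integral_const_mul, ← integral_const_mul, ← integral_sub (hdif _) (hdif _),
      ← integral_const_mul]
    refine Eq.trans ?_ (integral_add (hreg _) (((hdif _).sub (hdif _)).const_mul _))
    congr 1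
    ext x
    rw [show k + ((n + 1 : ℕ) : ℤ) = k + n + 1 by push_cast; ring]
    simp only [← mul_assoc, zpow_mul_ballKernel]
    have hle : (p : ℝ) ^ (k + n : ℤ) ≤ (p : ℝ) ^ (k + n + 1 : ℤ) :=
      zpow_le_zpow_right₀ one_lt_cast.le (by omega)
    by_cases h1 : ‖(x : ℚ_[p])‖ ≤ (p : ℝ) ^ (k + n : ℤ)
    · simp [h1, h1.trans hle]
    by_cases h2 : ‖(x : ℚ_[p])‖ ≤ (p : ℝ) ^ (k + n + 1 : ℤ)
    · have h3 : ‖(x : ℚ_[p])‖ = (p : ℝ) ^ (k + n + 1 : ℤ) := by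
        refine le_antisymm h2 (not_lt.1 fun h => h1 ?_)
        exact (Padic.norm_le_pow_iff_norm_lt_pow_add_one _ _).2 h
      simp only [h1, h2, if_true, if_false]
      rw [h3]
      ring
    · simp [h1, h2]

/-- The Riesz distribution evaluated at a function constant on `B_k`. -/
theorem riesz_apply_eq_sum {α : ℝ} (hα : 0 < α) {k : ℤ} {n : ℕ} (hN : N = k + n)
    (g : TestFunction p N) (hg : ∀ x : Ball p N, ‖(x : ℚ_[p])‖ ≤ (p : ℝ) ^ k → g x = g 0) :
    riesz p N (-α) g =
      (lam p N α : ℂ) * (∫ x, ballKernel p N (k + n) x * g x ∂(ballMeasure p N)) +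
        ∑ j ∈ Finset.range n, ((p : ℝ) ^ (-(k + j : ℤ) * α) : ℝ) *
          ((∫ x, ballKernel p N (k + j) x * g x ∂(ballMeasure p N)) -
            ∫ x, ballKernel p N (k + (j + 1 : ℕ)) x * g x ∂(ballMeasure p N)) := by
  have h0 : ∫ x, ballKernel p N (k + (0 : ℕ)) x * g x ∂(ballMeasure p N) = g 0 := by
    rw [Nat.cast_zero, add_zero, show g 0 = (∫ x, ballKernel p N k x ∂(ballMeasure p N)) * g 0 by
      rw [integral_ballKernel (by omega), one_mul], ← integral_mul_const]
    congr 1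
    ext x
    by_cases hx : ‖(x : ℚ_[p])‖ ≤ (p : ℝ) ^ k
    · rw [hg x hx]
    · rw [show ballKernel p N k x = 0 from if_neg hx, zero_mul, zero_mul]
  have h1 := integral_regularized_eq_sum (-α - 1) k n hN.ge g hg
  have h2 := sum_regularized_eq (p := p) α hα k
    (fun j => ∫ x, ballKernel p N (k + j) x * g x ∂(ballMeasure p N)) n
  have h3 : ∀ j : ℕ, k + ((j + 1 : ℕ) : ℤ) = k + j + 1 := fun j => by push_cast; ring
  simp only [h0, h3] at h2 ⊢
  rw [← h1, ← hN, ← lam_eq] at h2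
  rw [← hN, ← h2]
  change _ * g 0 + _ * _ = _
  rw [neg_neg, lam_eq]
  congr 2
  refine integral_congr_ae (Eventually.of_forall fun x => ?_)
  simp only
  rw [← mul_assoc, zpow_mul_ballKernel, if_pos (show ‖(x : ℚ_[p])‖ ≤ _ from x.2), one_mul]

/-- With `g(z) = ⟨u, φ(z + ·)⟩` for `φ` the normalised indicator of a ball about `x`, the averages
of `g` about `0` are the averages of `u` about `x`. -/
theorem conv_riesz_averageTest {α : ℝ} (hα : 0 < α) (u : L1 p N) (n : ℕ) (x : Ball p N) :
    conv (riesz p N (-α)) (ofL1 u) (averageTest (N - n) x) =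
      (lam p N α : ℂ) * convFun (ballKernel p N N) u x +
        ∑ i ∈ Finset.range n, ((p : ℝ) ^ (-(N - (i + 1 : ℕ) : ℤ) * α) : ℝ) *
          (convFun (ballKernel p N (N - (i + 1 : ℕ))) u x -
            convFun (ballKernel p N (N - i)) u x) := by
  have hu := L1.integrable_coeFn u
  set g : TestFunction p N := ⟨fun z => ofL1 u (translate z (averageTest (N - n) x)),
    (isLocallyConstant_translate _).comp _⟩ with hgdef
  have hgz : ∀ z, g z = convFun (ballKernel p N (N - n)) u (x - z) := by
    intro z
    rw [← ofL1_averageTest]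
    change ofL1 u _ = _
    congr 1
    ext y
    change ballKernel p N (N - n) (x - (z + y)) = ballKernel p N (N - n) (x - z - y)
    rw [sub_sub]
  have hg0 : ∀ z : Ball p N, ‖(z : ℚ_[p])‖ ≤ (p : ℝ) ^ (N - n : ℤ) → g z = g 0 := by
    intro z hz
    rw [hgz, hgz, sub_zero]
    unfold convFun
    congr 1
    ext y
    rw [sub_right_comm, ballKernel_sub _ hz]
  have havg : ∀ l : ℤ, N - n ≤ l → ∫ z, ballKernel p N l z * g z ∂(ballMeasure p N) =
      convFun (ballKernel p N l) u x := by
    intro l hl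
    conv_rhs => rw [← convFun_ballKernel_ballKernel (N := N) hl (by omega),
      ← convFun_assoc (stronglyMeasurable_ballKernel _) (exists_norm_ballKernel_le _)
      (stronglyMeasurable_ballKernel _) (exists_norm_ballKernel_le _) hu,
      convFun_comm (ballKernel p N l)]
    refine integral_congr_ae (Eventually.of_forall fun z => ?_)
    simp only
    rw [hgz, mul_comm]
  change riesz p N (-α) g = _
  rw [riesz_apply_eq_sum hα (show N = (N - n) + n by ring) g hg0, havg _ (by omega),
    ← Finset.sum_range_reflect]
  congr 1
  · rw [sub_add_cancel]
  · refine Finset.sum_congr rfl fun i hi => ?_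
    have hi' := Finset.mem_range.1 hi
    rw [havg _ (by omega), havg _ (by omega)]
    have e1 : N - n + ((n - 1 - i : ℕ) : ℤ) = N - (i + 1 : ℕ) := by omega
    have e2 : N - n + ((n - 1 - i + 1 : ℕ) : ℤ) = N - i := by omega
    rw [e1, e2]

/-! ### Radial multipliers -/

/-- A multiplier with decreasing weights `m n` is a positive combination of averages `a n`, so
that it moves `v` by at most a weighted mean of the distances of the averages from `v`. -/
theorem norm_sub_le_of_antitone_multiplier {E : Type*} [NormedAddCommGroup E] [NormedSpace ℂ E]
    {a b : ℕ → E} {v w : E} {m : ℕ → ℝ} {C ε : ℝ} {K : ℕ} (h0 : b 0 = a 0) (hm0 : m 0 = 1)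
    (hm : Antitone m) (hmnn : ∀ n, 0 ≤ m n)
    (hab : ∀ n, b (n + 1) - b n = (m (n + 1) : ℂ) • (a (n + 1) - a n))
    (hC : ∀ n, ‖a n - v‖ ≤ C) (hε : ∀ n, K ≤ n → ‖a n - v‖ ≤ ε)
    (hb : Tendsto b atTop (𝓝 w)) : ‖w - v‖ ≤ C * (1 - m K) + ε := by
  -- `r` is the part of `b n - v` coming from the averages `a 0, …, a (n - 1)`
  set r : ℕ → E := fun n => b n - (m n : ℂ) • (a n - v) - v with hr
  have hr0 : r 0 = 0 := by simp [hr, h0, hm0]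
  have hrs : ∀ n, r (n + 1) = r n + ((m n - m (n + 1) : ℝ) : ℂ) • (a n - v) := by
    intro n
    have h := hab n
    rw [sub_eq_iff_eq_add] at h
    simp only [hr, h]
    push_cast
    module
  have hstep : ∀ n D, ‖a n - v‖ ≤ D → ‖r (n + 1)‖ ≤ ‖r n‖ + D * (m n - m (n + 1)) := by
    intro n D hD
    rw [hrs]
    refine (norm_add_le _ _).trans ?_
    have hnn : 0 ≤ m n - m (n + 1) := sub_nonneg.2 (hm (Nat.le_succ n))
    rw [norm_smul, Complex.norm_real, Real.norm_of_nonneg hnn, mul_comm]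
    gcongr
  have h1 : ∀ n, ‖r n‖ ≤ C * (1 - m n) := by
    intro n
    induction n with
    | zero => simp [hr0, hm0]
    | succ n ih => linarith [hstep n C (hC n)]
  have h2 : ∀ n, K ≤ n → ‖r n‖ ≤ C * (1 - m K) + ε * (m K - m n) := by
    intro n hn
    induction n, hn using Nat.le_induction with
    | base => simpa using h1 K
    | succ n hn ih => linarith [hstep n ε (hε n hn)]
  have hεnn : 0 ≤ ε := (norm_nonneg _).trans (hε K le_rfl)
  have hmK : m K ≤ 1 := hm0 ▸ hm (Nat.zero_le K)
  refine le_of_tendsto (hb.sub_const v).norm (eventually_atTop.2 ⟨K, fun n hn => ?_⟩)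
  have h3 : b n - v = r n + (m n : ℂ) • (a n - v) := by
    simp only [hr]
    abel
  rw [h3]
  refine (norm_add_le _ _).trans ?_
  rw [norm_smul, Complex.norm_real, Real.norm_of_nonneg (hmnn n)]
  have h4 := mul_le_mul_of_nonneg_left (hε n hn) (hmnn n)
  have h5 := h2 n hn
  have h6 := mul_le_mul_of_nonneg_left hmK hεnn
  linarith

/-- Concavity of `x ↦ 1 - e^{-x}`: its slope at the origin decreases. -/
theorem one_sub_exp_neg_div_antitone {x y : ℝ} (hx : 0 < x) (hxy : x ≤ y) :
    (1 - Real.exp (-y)) / y ≤ (1 - Real.exp (-x)) / x := by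
  have hy : 0 < y := hx.trans_le hxy
  have h := convexOn_exp.2 (Set.mem_univ (-y)) (Set.mem_univ 0) (show 0 ≤ x / y by positivity)
    (sub_nonneg.2 ((div_le_one hy).2 hxy)) (add_sub_cancel _ _)
  simp only [smul_eq_mul, mul_zero, add_zero, Real.exp_zero, mul_one] at h
  rw [show x / y * -y = -x by field_simp] at h
  rw [le_div_iff₀ hx]
  have h2 : (1 - Real.exp (-y)) / y * x = x / y - x / y * Real.exp (-y) := by
    field_simp
  linarith

theorem one_sub_exp_neg_div_le_one {x : ℝ} (hx : 0 < x) : (1 - Real.exp (-x)) / x ≤ 1 := by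
  rw [div_le_one hx]
  linarith [Real.add_one_le_exp (-x)]

theorem one_sub_exp_neg_div_nonneg {x : ℝ} (hx : 0 < x) : 0 ≤ (1 - Real.exp (-x)) / x :=
  div_nonneg (sub_nonneg.2 (Real.exp_le_one_iff.2 (by linarith))) hx.le

/-- The derivative at the origin of `t ↦ 1 - e^{-t μ}`. -/
theorem tendsto_one_sub_exp_neg_mul_div (μ : ℝ) :
    Tendsto (fun t : ℝ => t⁻¹ * (1 - Real.exp (-(t * μ)))) (𝓝[>] 0) (𝓝 μ) := by
  have h : HasDerivAt (fun t : ℝ => 1 - Real.exp (-(t * μ))) μ 0 := by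
    have h1 := (((hasDerivAt_id (0 : ℝ)).mul_const μ).neg.exp).const_sub 1
    simpa using h1
  have h2 := h.tendsto_slope_zero_right
  simpa using h2

/-! ### The semigroup and its generator -/

/-- The average of `u` over the ball of radius `p ^ (N - n)` about `x`. -/
def average (n : ℕ) (x : Ball p N) : L1 p N →L[ℂ] ℂ :=
  pairing (averageTest (N - n) x)

theorem average_apply (n : ℕ) (x : Ball p N) (u : L1 p N) :
    average n x u = convFun (ballKernel p N (N - n)) u x :=
  ofL1_averageTest u _ x

theorem coeFn_averageOp (n : ℕ) (u : L1 p N) :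
    averageOp (N - n) u =ᵐ[ballMeasure p N] fun x => average n x u := by
  filter_upwards [coeFn_kernelOp (stronglyMeasurable_ballKernel (N - n))
    (exists_norm_ballKernel_le (N - n)) u] with x hx
  rw [average_apply]
  exact hx

variable (p N) in
/-- The eigenvalue `p ^ (-k α) - λ`, `k = N - n - 1`, of `A_N` on the functions constant on the
cosets of `B_k` with zero averages over the cosets of `B_{k+1}`. -/
def eigenvalue (α : ℝ) (n : ℕ) : ℝ :=
  (p : ℝ) ^ (-(N - (n + 1 : ℕ) : ℤ) * α) - lam p N α

theorem eigenvalue_monotone {α : ℝ} (hα : 0 < α) : Monotone (eigenvalue p N α) := by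
  intro m n hmn
  unfold eigenvalue
  refine sub_le_sub_right (Real.rpow_le_rpow_of_exponent_le one_lt_cast.le ?_) _
  have : (m : ℝ) ≤ n := by exact_mod_cast hmn
  push_cast
  nlinarith

theorem eigenvalue_pos {α : ℝ} (hα : 0 < α) (n : ℕ) : 0 < eigenvalue p N α n := by
  refine sub_pos.2 ((lam_lt hα).trans_le ?_)
  refine Real.rpow_le_rpow_of_exponent_le one_lt_cast.le ?_
  have : (0 : ℝ) ≤ n := n.cast_nonneg
  push_cast
  nlinarith

theorem semigroupT_apply {α t : ℝ} (ht : 0 < t) (u : L1 p N) :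
    semigroupT p N α t u = kernelOp (ballHeatKernel p N α t)
      (stronglyMeasurable_ballHeatKernel p N α t) (exists_norm_ballHeatKernel_le p N α t) u := by
  unfold semigroupT
  rw [if_pos ht]

theorem average_zero_semigroupT {α t : ℝ} (hα : 1 ≤ α) (ht : 0 < t) (u : L1 p N) (x : Ball p N) :
    average 0 x (semigroupT p N α t u) = average 0 x u := by
  rw [average_apply, average_apply, semigroupT_apply ht, convFun_kernelOp
    (stronglyMeasurable_ballKernel _) (exists_norm_ballKernel_le _)]
  simp only [Nat.cast_zero, sub_zero]
  rw [convFun_ballKernel_ballHeatKernel_top hα ht]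

theorem average_succ_sub_semigroupT {α t : ℝ} (hα : 1 ≤ α) (ht : 0 < t) (u : L1 p N) (n : ℕ)
    (x : Ball p N) :
    average (n + 1) x (semigroupT p N α t u) - average n x (semigroupT p N α t u) =
      (Real.exp (-(t * eigenvalue p N α n)) : ℂ) * (average (n + 1) x u - average n x u) := by
  have hu := L1.integrable_coeFn u
  have hint : ∀ l, Integrable (fun y => ballKernel p N l (x - y) * u y) (ballMeasure p N) :=
    fun l => integrable_kernel (stronglyMeasurable_ballKernel l) (exists_norm_ballKernel_le l) u x
  set T := semigroupT p N α t u with hT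
  have hintT : ∀ l, Integrable (fun y => ballKernel p N l (x - y) * T y) (ballMeasure p N) :=
    fun l => integrable_kernel (stronglyMeasurable_ballKernel l) (exists_norm_ballKernel_le l) T x
  have hN : N - ((n + 1 : ℕ) : ℤ) + 1 = N - n := by push_cast; ring
  have hker := convFun_ballKernel_sub_ballHeatKernel (p := p) (N := N) hα ht
    (l := N - ((n + 1 : ℕ) : ℤ)) (by omega)
  rw [hN] at hker
  set k₁ := ballKernel p N (N - ((n + 1 : ℕ) : ℤ)) with hk₁
  set k₀ := ballKernel p N (N - (n : ℤ)) with hk₀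
  -- both sides are convolutions with the difference of two normalised indicators of balls
  have hsm : StronglyMeasurable (k₁ - k₀) :=
    (stronglyMeasurable_ballKernel _).sub (stronglyMeasurable_ballKernel _)
  have hsb : ∃ C, ∀ y, ‖(k₁ - k₀) y‖ ≤ C := by
    obtain ⟨C₁, h₁⟩ := exists_norm_ballKernel_le (p := p) (N := N) (N - ((n + 1 : ℕ) : ℤ))
    obtain ⟨C₀, h₀⟩ := exists_norm_ballKernel_le (p := p) (N := N) (N - (n : ℤ))
    exact ⟨C₁ + C₀, fun y => (norm_sub_le _ _).trans (add_le_add (h₁ y) (h₀ y))⟩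
  have hsub : ∀ f : Ball p N → ℂ, (∀ l, Integrable (fun y => ballKernel p N l (x - y) * f y)
      (ballMeasure p N)) → convFun k₁ f x - convFun k₀ f x = convFun (k₁ - k₀) f x := by
    intro f hf
    unfold convFun
    rw [← integral_sub (hf _) (hf _)]
    congr 1
    ext y
    rw [Pi.sub_apply, sub_mul]
  rw [average_apply, average_apply, average_apply, average_apply, hsub _ hintT, hsub _ hint, hT,
    semigroupT_apply ht, convFun_kernelOp hsm hsb]
  have hkz : convFun (k₁ - k₀) (ballHeatKernel p N α t) =
      fun z => (Real.exp (-(t * eigenvalue p N α n)) : ℂ) * (k₁ - k₀) z := by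
    ext z
    refine Eq.trans ?_ (hker z)
    obtain ⟨C, hC⟩ := exists_norm_ballHeatKernel_le p N α t
    have hi : ∀ l, Integrable (fun y => ballKernel p N l (z - y) * ballHeatKernel p N α t y)
        (ballMeasure p N) := fun l => by
      obtain ⟨C', hC'⟩ := exists_norm_ballKernel_le (p := p) (N := N) l
      refine Integrable.bdd_mul (c := C') (Integrable.of_bound
        (stronglyMeasurable_ballHeatKernel p N α t).aestronglyMeasurable C
        (Eventually.of_forall hC)) ?_ (Eventually.of_forall fun y => hC' _)
      exact ((stronglyMeasurable_ballKernel l).comp_measurable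
        (measurable_const.sub measurable_id)).aestronglyMeasurable
    unfold convFun
    rw [← integral_sub (hi _) (hi _)]
    congr 1
    ext y
    rw [Pi.sub_apply, sub_mul]
  rw [hkz]
  unfold convFun
  simp_rw [mul_assoc]
  rw [integral_const_mul]

variable (p N) in
/-- The difference quotient `t⁻¹ (u - T_N(t) u)` whose limit is `A_N u`. -/
def diffQuotient (α : ℝ) (u : L1 p N) (t : ℝ) : L1 p N :=
  (t : ℂ)⁻¹ • (u - semigroupT p N α t u)

theorem average_zero_diffQuotient {α t : ℝ} (hα : 1 ≤ α) (ht : 0 < t) (u : L1 p N)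
    (x : Ball p N) : average 0 x (diffQuotient p N α u t) = 0 := by
  rw [diffQuotient, map_smul, map_sub, average_zero_semigroupT hα ht, sub_self, smul_zero]

theorem average_succ_sub_diffQuotient {α t : ℝ} (hα : 1 ≤ α) (ht : 0 < t) (u : L1 p N) (n : ℕ)
    (x : Ball p N) :
    average (n + 1) x (diffQuotient p N α u t) - average n x (diffQuotient p N α u t) =
      ((t⁻¹ * (1 - Real.exp (-(t * eigenvalue p N α n))) : ℝ) : ℂ) *
        (average (n + 1) x u - average n x u) := by
  have h := average_succ_sub_semigroupT hα ht u n x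
  rw [diffQuotient, map_smul, map_smul, map_sub, map_sub, smul_eq_mul, smul_eq_mul, ← mul_sub,
    sub_sub_sub_comm, h]
  push_cast
  ring

/-- The identity `f_{-α} * u = v + λ u` in `𝒟'(B_N)`, read off on averages: `v` is obtained from
`u` by multiplication by the eigenvalues. -/
theorem conv_riesz_eq_ofL1_iff {α : ℝ} (hα : 0 < α) (u v : L1 p N) :
    conv (riesz p N (-α)) (ofL1 u) = ofL1 (v + (lam p N α : ℂ) • u) ↔
      (∀ x, average 0 x v = 0) ∧ ∀ n x, average (n + 1) x v - average n x v =
        (eigenvalue p N α n : ℂ) * (average (n + 1) x u - average n x u) := by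
  have hconv : ∀ (n : ℕ) (x : Ball p N),
      conv (riesz p N (-α)) (ofL1 u) (averageTest (N - n) x) =
      (lam p N α : ℂ) * average 0 x u + ∑ i ∈ Finset.range n,
        ((eigenvalue p N α i + lam p N α : ℝ) : ℂ) * (average (i + 1) x u - average i x u) := by
    intro n x
    rw [conv_riesz_averageTest hα]
    simp only [average_apply, eigenvalue, sub_add_cancel, Nat.cast_zero, sub_zero]
  have hav : ∀ (n : ℕ) (x : Ball p N),
      ofL1 (v + (lam p N α : ℂ) • u) (averageTest (N - n) x) =
        average n x v + (lam p N α : ℂ) * average n x u := by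
    intro n x
    change average n x (v + (lam p N α : ℂ) • u) = _
    rw [map_add, map_smul, smul_eq_mul]
  constructor
  · intro h
    have key : ∀ n x, average n x v = (lam p N α : ℂ) * (average 0 x u - average n x u) +
        ∑ i ∈ Finset.range n, ((eigenvalue p N α i + lam p N α : ℝ) : ℂ) *
          (average (i + 1) x u - average i x u) := by
      intro n x
      have h1 := hav n x
      rw [← h, hconv] at h1
      linear_combination -h1
    refine ⟨fun x => by simp [key 0 x], fun n x => ?_⟩
    rw [key, key, Finset.sum_range_succ]
    push_cast
    ring
  · rintro ⟨h0, hs⟩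
    refine distribution_ext fun n x => ?_
    rw [hconv, hav]
    induction n with
    | zero => simp [h0]
    | succ n ih =>
      rw [Finset.sum_range_succ]
      push_cast at ih ⊢
      linear_combination ih - hs n x

/-- Convolution with `f_{-α}` is the limit of the difference quotients, whenever these converge. -/
theorem conv_riesz_of_tendsto {α : ℝ} (hα : 1 ≤ α) {u v : L1 p N}
    (h : Tendsto (diffQuotient p N α u) (𝓝[>] 0) (𝓝 v)) :
    conv (riesz p N (-α)) (ofL1 u) = ofL1 (v + (lam p N α : ℂ) • u) := by
  rw [conv_riesz_eq_ofL1_iff (by linarith)]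
  have hlim : ∀ n x, Tendsto (fun t => average n x (diffQuotient p N α u t)) (𝓝[>] 0)
      (𝓝 (average n x v)) := fun n x => ((average n x).continuous.tendsto v).comp h
  constructor
  · intro x
    refine tendsto_nhds_unique (hlim 0 x) (tendsto_const_nhds.congr' ?_)
    filter_upwards [self_mem_nhdsWithin] with t ht
    exact (average_zero_diffQuotient hα ht u x).symm
  · intro n x
    refine tendsto_nhds_unique ((hlim (n + 1) x).sub (hlim n x)) ?_
    have h1 := ((Complex.continuous_ofReal.tendsto _).comp
      (tendsto_one_sub_exp_neg_mul_div (eigenvalue p N α n))).mul_const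
      (average (n + 1) x u - average n x u)
    refine h1.congr' ?_
    filter_upwards [self_mem_nhdsWithin] with t ht
    exact (average_succ_sub_diffQuotient hα ht u n x).symm

/-- If `v` is obtained from `u` by multiplication by the eigenvalues, then the difference
quotient of `u` is obtained from `v` by the multipliers `(1 - e^{-tμ}) / (tμ)`, which decrease
in `μ` and tend to `1` as `t → 0`. -/
theorem tendsto_diffQuotient {α : ℝ} (hα : 1 ≤ α) {u v : L1 p N}
    (h : conv (riesz p N (-α)) (ofL1 u) = ofL1 (v + (lam p N α : ℂ) • u)) :
    Tendsto (diffQuotient p N α u) (𝓝[>] 0) (𝓝 v) := by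
  have hα0 : 0 < α := by linarith
  obtain ⟨h0, hs⟩ := (conv_riesz_eq_ofL1_iff hα0 u v).1 h
  have hC : ∀ n : ℕ, ‖averageOp (N - n) v - v‖ ≤ 2 * ‖v‖ := fun n => by
    have := norm_averageOp_le (show N - (n : ℤ) ≤ N by omega) v
    have := norm_sub_le (averageOp (N - n) v) v
    linarith
  rw [Metric.tendsto_nhds]
  intro ε hε
  obtain ⟨K, hK⟩ := Metric.tendsto_atTop.1 (tendsto_averageOp v) (ε / 2) (by linarith)
  have hmlim : Tendsto (fun t : ℝ => 2 * ‖v‖ * (1 -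
      (1 - Real.exp (-(t * eigenvalue p N α K))) / (t * eigenvalue p N α K))) (𝓝[>] 0) (𝓝 0) := by
    have h1 := (tendsto_one_sub_exp_neg_mul_div (eigenvalue p N α K)).div_const
      (eigenvalue p N α K)
    rw [div_self (eigenvalue_pos hα0 K).ne'] at h1
    have h2 := (h1.const_sub 1).const_mul (2 * ‖v‖)
    rw [sub_self, mul_zero] at h2
    refine h2.congr fun t => ?_
    rw [← div_div, inv_mul_eq_div]
  filter_upwards [hmlim.eventually (gt_mem_nhds (show 0 < ε / 2 by linarith)),
    self_mem_nhdsWithin] with t ht1 ht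
  have ht' : 0 < t := ht
  have hpos : ∀ n, 0 < t * eigenvalue p N α n := fun n => mul_pos ht' (eigenvalue_pos hα0 n)
  -- both averages over `B_N` are zero, so that the weight at `n = 0` is free; total weight one
  -- requires it to be `1`
  set m : ℕ → ℝ := fun n => Nat.casesOn n 1
    fun n => (1 - Real.exp (-(t * eigenvalue p N α n))) / (t * eigenvalue p N α n) with hm
  rw [dist_eq_norm]
  have key := norm_sub_le_of_antitone_multiplier (K := K + 1) (m := m) (v := v)
    (a := fun n : ℕ => averageOp (N - n) v)
    (b := fun n : ℕ => averageOp (N - n) (diffQuotient p N α u t))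
    (w := diffQuotient p N α u t) (C := 2 * ‖v‖) (ε := ε / 2) ?_ rfl ?_ ?_ ?_ hC ?_
    (tendsto_averageOp _)
  · refine key.trans_lt ?_
    have : m (K + 1) = (1 - Real.exp (-(t * eigenvalue p N α K))) / (t * eigenvalue p N α K) := rfl
    rw [this]
    linarith
  · refine Lp.ext ?_
    filter_upwards [coeFn_averageOp 0 v, coeFn_averageOp 0 (diffQuotient p N α u t)] with x h1 h2
    rw [h1, h2, average_zero_diffQuotient hα ht', h0]
  · refine antitone_nat_of_succ_le fun n => ?_
    cases n with
    | zero => exact one_sub_exp_neg_div_le_one (hpos 0)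
    | succ n =>
      refine one_sub_exp_neg_div_antitone (hpos n) ?_
      exact mul_le_mul_of_nonneg_left (eigenvalue_monotone hα0 n.le_succ) ht'.le
  · intro n
    cases n with
    | zero => exact zero_le_one
    | succ n => exact one_sub_exp_neg_div_nonneg (hpos n)
  · intro n
    refine Lp.ext ?_
    filter_upwards [coeFn_averageOp n v, coeFn_averageOp n (diffQuotient p N α u t),
      coeFn_averageOp (n + 1) v, coeFn_averageOp (n + 1) (diffQuotient p N α u t),
      Lp.coeFn_sub (averageOp (N - (n + 1 : ℕ)) v) (averageOp (N - n) v),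
      Lp.coeFn_sub (averageOp (N - (n + 1 : ℕ)) (diffQuotient p N α u t))
        (averageOp (N - n) (diffQuotient p N α u t)),
      Lp.coeFn_smul (m (n + 1) : ℂ) (averageOp (N - (n + 1 : ℕ)) v - averageOp (N - n) v)]
      with x h1 h2 h3 h4 h5 h6 h7
    rw [h6, h7, Pi.sub_apply, Pi.smul_apply, h5, Pi.sub_apply, h1, h2, h3, h4,
      average_succ_sub_diffQuotient hα ht', hs, smul_eq_mul, ← mul_assoc, ← Complex.ofReal_mul]
    congr 2
    have hne := (eigenvalue_pos (p := p) (N := N) hα0 n).ne'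
    have : m (n + 1) = (1 - Real.exp (-(t * eigenvalue p N α n))) / (t * eigenvalue p N α n) := rfl
    rw [this]
    field_simp
  · intro n hn
    rw [← dist_eq_norm]
    exact (hK n (by omega)).le

end VladimirovBall

end

theorem theorem3 (p : ℕ) [Fact p.Prime] (N : ℤ) (α : ℝ) (hα : 1 < α) :
    (∀ u : VladimirovBall.L1 p N,
      u ∈ (VladimirovBall.generatorA p N α).domain ↔
        ∃ v : VladimirovBall.L1 p N,
          VladimirovBall.conv (VladimirovBall.riesz p N (-α)) (VladimirovBall.ofL1 u) =
            VladimirovBall.ofL1 v) ∧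
    ∀ u : (VladimirovBall.generatorA p N α).domain,
      VladimirovBall.ofL1 (VladimirovBall.generatorA p N α u) =
        VladimirovBall.conv (VladimirovBall.riesz p N (-α)) (VladimirovBall.ofL1 u) -
          (VladimirovBall.lam p N α : ℂ) • VladimirovBall.ofL1 (u : VladimirovBall.L1 p N) := by
  refine ⟨fun u => ⟨?_, ?_⟩, fun u => ?_⟩
  · rintro ⟨v, hv⟩
    exact ⟨_, VladimirovBall.conv_riesz_of_tendsto hα.le hv⟩
  · rintro ⟨v, hv⟩
    refine ⟨v - (VladimirovBall.lam p N α : ℂ) • u, VladimirovBall.tendsto_diffQuotient hα.le ?_⟩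
    rw [sub_add_cancel, hv]
  · rw [VladimirovBall.conv_riesz_of_tendsto hα.le u.2.choose_spec, VladimirovBall.ofL1_add,
      VladimirovBall.ofL1_smul, add_sub_cancel_right]
    rfl
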